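/- For $\alpha,\theta\in\mathbb R$ let $H_{\alpha,\theta}$ be the almost Mathieu operator on $\ell^2(\mathbb Z)$, $$(H_{\alpha,\theta}\phi)(n)=\phi(n-1)+\phi(n+1)+2\cos\bigl(2\pi(\alpha n+\theta)\bigr)\phi(n),\qquad n\in\mathbb Z,$$ and let $S(\alpha)=\bigcup_{\theta\in(0,1]}\operatorname{spec}(H_{\alpha,\theta})\subset\mathbb R$. Let $q\ge 3$ be odd and $p$ a positive integer coprime to $q$, and let $$\sigma(E)=-\operatorname{tr}\left\{\begin{pmatrix}E-2\cos\left(\frac{2\pi p}{q}+\frac{\pi}{2q}\right)&-1\\1&0\end{pmatrix}\cdots\begin{pmatrix}E-2\cos\left(\frac{2\pi qp}{q}+\frac{\pi}{2q}\right)&-1\\1&0\end{pmatrix}\right\}$$ (the factors are those for $k\,p/q$, $k=1,2,\dots,q$, in this order), a polynomial of degree $q$ with $q$ simple real zeros $$\lambda_{-(q-1)/2}<\dots<\lambda_{-1}<\lambda_0<\lambda_1<\dots<\lambda_{(q-1)/2}.$$ The set $S(p/q)$ consists of $q$ disjoint compact intervals (bands), each containing exactly one $\lambda_j$. Let $B_j=[l_j,r_j]$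 be the band (connected component of $S(p/q)$) that contains $\lambda_j$; let $w_j=r_j-\lambda_j$ be the width of the part of $B_j$ to the right of its center $\lambda_j$, and let $\Delta_j=l_{j+1}-r_j$ be the length of the gap $(r_j,l_{j+1})$ between $B_j$ and $B_{j+1}$. Then $$\Delta_0>\left(\frac{w_0}{4}\right)^2,$$ $$\Delta_j>\frac{w_j^2}{4C_0^{2(j+1)}},\qquad 1\le j<\frac{q-1}{2},$$ $$\Delta_j>\left(\frac{w_0}{8}\right)^{2j},\qquad 1\le j<\frac{q-1}{2},$$ where $C_0=1+\dfrac{2e}{\sqrt5-1}=5.398\dots$. -/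

import Mathlib

open Polynomial

/-- The complex Hilbert space `ℓ²(ℤ)`. -/
abbrev EllTwo : Type := lp (fun _ : ℤ => ℂ) 2

/-- A translate of a square-summable sequence is square-summable. -/
theorem memEllTwo_translate (k : ℤ) (φ : EllTwo) : Memℓp (fun n : ℤ => φ (n + k)) 2 := by
  have h := (memℓp_gen_iff (p := 2) (by norm_num)).1 (lp.memℓp φ)
  exact (memℓp_gen_iff (p := 2) (by norm_num)).2 ((Equiv.addRight k).summable_iff.2 h)

/-- The potential `2 cos 2π(αn + θ)` at the site `n`. -/
noncomputable def potential (α θ : ℝ) (n : ℤ) : ℝ := 2 * Real.cos (2 * Real.pi * (α * n + θ))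

theorem norm_potential_mul_le (α θ : ℝ) (n : ℤ) (z : ℂ) :
    ‖(potential α θ n : ℂ) * z‖ ≤ ‖(2 : ℂ) * z‖ := by
  rw [norm_mul, norm_mul, Complex.norm_real, Complex.norm_ofNat]
  refine mul_le_mul_of_nonneg_right ?_ (norm_nonneg z)
  rw [potential, norm_mul, Real.norm_ofNat, Real.norm_eq_abs]
  nlinarith [Real.abs_cos_le_one (2 * Real.pi * (α * n + θ))]

theorem memEllTwo_potential (α θ : ℝ) (φ : EllTwo) :
    Memℓp (fun n : ℤ => (potential α θ n : ℂ) * φ n) 2 :=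
  Memℓp.mono' ((lp.memℓp φ).const_mul (2 : ℂ)) fun n => norm_potential_mul_le α θ n (φ n)

/-- The translation `φ ↦ φ(· + k)` as a bounded operator on `ℓ²(ℤ)`. -/
noncomputable def translation (k : ℤ) : EllTwo →L[ℂ] EllTwo :=
  LinearMap.mkContinuous
    { toFun := fun φ => ⟨fun n => φ (n + k), memEllTwo_translate k φ⟩
      map_add' := fun _ _ => rfl
      map_smul' := fun _ _ => rfl } 1 (fun φ => by
    rw [one_mul]
    refine le_of_eq ?_
    rw [lp.norm_eq_tsum_rpow (by norm_num), lp.norm_eq_tsum_rpow (by norm_num)]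
    exact congrArg (· ^ (1 / (2 : ENNReal).toReal))
      ((Equiv.addRight k).tsum_eq (fun n => ‖φ n‖ ^ (2 : ENNReal).toReal)))

/-- Multiplication by the potential as a bounded operator on `ℓ²(ℤ)`. -/
noncomputable def potentialOp (α θ : ℝ) : EllTwo →L[ℂ] EllTwo :=
  LinearMap.mkContinuous
    { toFun := fun φ => ⟨fun n => (potential α θ n : ℂ) * φ n, memEllTwo_potential α θ φ⟩
      map_add' := fun φ ψ => by ext n; exact mul_add _ _ _
      map_smul' := fun c φ => by ext n; exact mul_left_comm _ _ _ } 2 (fun φ => by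
    have h : ‖(2 : ℂ) • φ‖ = 2 * ‖φ‖ := by rw [norm_smul, Complex.norm_ofNat]
    rw [← h]
    exact lp.norm_mono (by norm_num) fun n => norm_potential_mul_le α θ n (φ n))

/-- The almost Mathieu operator `H_{α,θ}` at critical coupling. -/
noncomputable def almostMathieu (α θ : ℝ) : EllTwo →L[ℂ] EllTwo :=
  translation (-1) + translation 1 + potentialOp α θ

theorem almostMathieu_apply (α θ : ℝ) (φ : EllTwo) (n : ℤ) :
    almostMathieu α θ φ n =
      φ (n - 1) + φ (n + 1) + 2 * Real.cos (2 * Real.pi * (α * n + θ)) * φ n := by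
  have h : almostMathieu α θ φ n = φ (n + -1) + φ (n + 1) + (potential α θ n : ℂ) * φ n := rfl
  rw [h, potential, ← sub_eq_add_neg]
  push_cast
  rfl

/-- `S(α)`: the union over `θ ∈ (0,1]` of the spectra of `H_{α,θ}`, as a subset of `ℝ`
(each `H_{α,θ}` is self-adjoint). -/
def specUnion (α : ℝ) : Set ℝ :=
  {E : ℝ | ∃ θ ∈ Set.Ioc (0 : ℝ) 1, (E : ℂ) ∈ spectrum ℂ (almostMathieu α θ)}

/-- The transfer matrix at the site `k`, for the phase `π/(2q)`, with entries in `ℝ[E]`. -/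
noncomputable def transferMatrix (p q k : ℕ) : Matrix (Fin 2) (Fin 2) ℝ[X] :=
  !![X - C (2 * Real.cos (2 * Real.pi * (k * p / q) + Real.pi / (2 * q))), -1; 1, 0]

/-- The discriminant `σ(E)`: minus the trace of the ordered product of the transfer matrices at
the sites `1, 2, …, q`. -/
noncomputable def discriminant (p q : ℕ) : ℝ[X] :=
  -((List.range q).map fun k => transferMatrix p q (k + 1)).prod.trace

/-- `λ_j`, `-(q-1)/2 ≤ j ≤ (q-1)/2` (`q` odd): the zeros of `σ`, numbered from left to right,
`λ_{-(q-1)/2}` being the smallest. -/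
noncomputable def bandCenter (p q : ℕ) (j : ℤ) : ℝ :=
  ((discriminant p q).roots.sort (· ≤ ·)).getD (j + ((q - 1) / 2 : ℕ)).toNat 0

/-- The `j`-th band `B_j` of `S(p/q)`: the connected component of `S(p/q)` that contains `λ_j`. -/
def band (p q : ℕ) (j : ℤ) : Set ℝ :=
  connectedComponentIn (specUnion ((p : ℝ) / q)) (bandCenter p q j)

/-- The left edge of `B_j` (`η_j` if `j` is even, `μ_j` if `j` is odd). -/
noncomputable def leftEdge (p q : ℕ) (j : ℤ) : ℝ := sInf (band p q j)

/-- The right edge of `B_j` (`μ_j` if `j` is even, `η_j` if `j` is odd). -/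
noncomputable def rightEdge (p q : ℕ) (j : ℤ) : ℝ := sSup (band p q j)

/-- `w_j`: the width of the part of `B_j` to the right of its center `λ_j`. -/
noncomputable def rightWidth (p q : ℕ) (j : ℤ) : ℝ := rightEdge p q j - bandCenter p q j

/-- `Δ_j`: the length of the gap `G_j` between the bands `B_j` and `B_{j+1}`. -/
noncomputable def gapLength (p q : ℕ) (j : ℤ) : ℝ := leftEdge p q (j + 1) - rightEdge p q j

/-- The constant `C₀ = 1 + 2e/(√5 - 1)`. -/
noncomputable def gapConst : ℝ := 1 + 2 * Real.exp 1 / (Real.sqrt 5 - 1)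

/-! The gaps of the critical almost Mathieu operator at a rational frequency `p/q`, `q = 2m + 1`.

By Chambers' formula the trace of the transfer matrices over a period depends on the phase `φ` only
through an additive constant: it equals `P - 2 cos (qφ)` with `P = -σ` (`phaseTrace_eq`). Since the
trace of the monodromy matrix acts as the sum of the translations by `±q`
(`trace_smul_eq_of_recurrence`), the polynomial `P` satisfies `|P| ≤ 4` on the spectrum, and
conversely a point with `|P| ≤ 4` has a periodic eigenvector for a suitable phase. Hence
`S(p/q) = {|P| ≤ 4}` (`specUnion_eq`).

The quantitative input, in the manner of Choi, Elliott and Yui, is that `|P'| ≥ 1` wherever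
`|P| ≤ 4`. For a level `0 ≤ c ≤ 4` the zeros of `P - c` are the eigenvalues of a Harper matrix
`S + S⁻¹ + U + U⁻¹`, where `S` is the cyclic shift and `U` is diagonal with `U S = γ S U` for a
primitive `q`-th root of unity `γ`. In a polynomial `g` of degree `q - 1 = 2m` in this matrix that
is monic, the coefficient of `S^m U^m` is a Gaussian binomial coefficient `[2m choose m]` at `γ`,
whose modulus is one (`norm_weylCoeff_aeval`). With `g = 0` at all eigenvalues this is impossible
when there are fewer than `q` of them, so that the zeros of `P - c` are simple; with
`g = (P - c) / (X - x)` it gives `1 ≤ |g(x)| = |P'(x)|` (`exists_level_roots`).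

At the right edge `r` of the band `j ≥ 0` the derivative of `P` is the product of the distances from
`r` to the other points of its level `±4`, and one of these distances is the length of the gap. If
`z ≥ 0` is a zero of `P` to the left of `r`, the product of the distances from `z` to all points of
the level is `4`. Since `P` is odd, the level point `k ≥ j + 2` lies closer to the origin than the
level point `-(k + 1)`, and this pair of factors does not increase when `z` is replaced by `r`; only
`2j + 2` factors remain to be compared (`sq_sub_lt_mul_gap`). The three estimates are the
choices `z = 0` for the band `0`, `z = λ_j`, and `z = 0` for the band `j`. The second one requires
that the two halves of a band have comparable widths, which follows from `1 + x ≤ exp x` and from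
the monotonicity of `P` up to the edge of the band (`width_le_mul_exp`). -/

/-! ### Products of transfer matrices -/

section TransferProducts

variable {R : Type*} [CommRing R]

/-- The ordered product of the matrices `!![a k, -x; x, 0]` for `k = 0, …, n - 1`. For `x = 1` it is
a product of transfer matrices; the general `x` allows for clearing denominators. -/
def transferProd (x : R) (a : ℕ → R) (n : ℕ) : Matrix (Fin 2) (Fin 2) R :=
  ((List.range n).map fun k => !![a k, -x; x, 0]).prod

theorem transferProd_zero (x : R) (a : ℕ → R) : transferProd x a 0 = 1 := rfl

theorem transferProd_succ (x : R) (a : ℕ → R) (n : ℕ) :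
    transferProd x a (n + 1) = transferProd x a n * !![a n, -x; x, 0] := by
  simp [transferProd, List.range_succ]

theorem transferProd_succ' (x : R) (a : ℕ → R) (n : ℕ) :
    transferProd x a (n + 1) = !![a 0, -x; x, 0] * transferProd x (fun k => a (k + 1)) n := by
  simp [transferProd, List.range_succ_eq_map, Function.comp_def]

theorem det_transferProd (a : ℕ → R) (n : ℕ) : (transferProd 1 a n).det = 1 := by
  induction n with
  | zero => simp [transferProd_zero]
  | succ n ih => rw [transferProd_succ, Matrix.det_mul, ih]; simp [Matrix.det_fin_two]

theorem map_transferProd {S : Type*} [CommRing S] (f : R →+* S) (x : R) (a : ℕ → R) (n : ℕ) :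
    (transferProd x a n).map f = transferProd (f x) (fun k => f (a k)) n := by
  induction n with
  | zero => simp [transferProd_zero, Matrix.map_one]
  | succ n ih =>
    rw [transferProd_succ, transferProd_succ, Matrix.map_mul, ih]
    congr 1
    ext i j
    fin_cases i <;> fin_cases j <;> simp

theorem map_trace_transferProd {S : Type*} [CommRing S] (f : R →+* S) (x : R) (a : ℕ → R) (n : ℕ) :
    f (transferProd x a n).trace = (transferProd (f x) (fun k => f (a k)) n).trace := by
  rw [← map_transferProd, Matrix.trace_fin_two, Matrix.trace_fin_two]
  simp

theorem transferProd_mul (c x : R) (a : ℕ → R) (n : ℕ) :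
    transferProd (c * x) (fun k => c * a k) n = c ^ n • transferProd x a n := by
  induction n with
  | zero => simp [transferProd_zero]
  | succ n ih =>
    have h : (!![c * a n, -(c * x); c * x, 0] : Matrix (Fin 2) (Fin 2) R)
        = c • !![a n, -x; x, 0] := by
      ext i j
      fin_cases i <;> fin_cases j <;> simp
    rw [transferProd_succ, transferProd_succ, ih, h, smul_mul_smul_comm, pow_succ]

/-- The trace does not change when a periodic sequence of factors is shifted by one. -/
theorem trace_transferProd_shift (x : R) (a : ℕ → R) (n : ℕ) (h : a (n + 1) = a 0) :
    (transferProd x (fun k => a (k + 1)) (n + 1)).trace = (transferProd x a (n + 1)).trace := by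
  rw [transferProd_succ, transferProd_succ', Matrix.trace_mul_comm, h]

/-- Conjugation by `diag(1, -1)` shows that changing the sign of all diagonal entries changes
the trace by the factor `(-1)ⁿ`. -/
theorem trace_transferProd_neg (a : ℕ → R) (n : ℕ) :
    (transferProd 1 (fun k => -a k) n).trace = (-1) ^ n * (transferProd 1 a n).trace := by
  have h : ∀ n, transferProd 1 (fun k => -a k) n
      = (-1 : R) ^ n • (!![1, 0; 0, -1] * transferProd 1 a n * !![1, 0; 0, -1]) := by
    intro n
    induction n with
    | zero =>
      rw [transferProd_zero, transferProd_zero]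
      ext i j
      fin_cases i <;> fin_cases j <;> simp
    | succ n ih =>
      have h1 : (!![-a n, -1; 1, 0] : Matrix (Fin 2) (Fin 2) R)
          = (-1 : R) • (!![1, 0; 0, -1] * !![a n, -1; 1, 0] * !![1, 0; 0, -1]) := by
        ext i j
        fin_cases i <;> fin_cases j <;> simp
      have h2 : (!![1, 0; 0, -1] * !![1, 0; 0, -1] : Matrix (Fin 2) (Fin 2) R) = 1 := by
        ext i j
        fin_cases i <;> fin_cases j <;> simp
      rw [transferProd_succ, transferProd_succ, ih, h1, smul_mul_smul_comm, pow_succ]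
      congr 1
      calc _ = !![1, 0; 0, -1] * transferProd 1 a n * (!![1, 0; 0, -1] * !![1, 0; 0, -1]) *
            !![a n, -1; 1, 0] * !![1, 0; 0, -1] := by simp only [Matrix.mul_assoc]
        _ = _ := by rw [h2, mul_one, ← Matrix.mul_assoc]
  rw [h, Matrix.trace_smul, Matrix.trace_mul_comm, ← Matrix.mul_assoc, smul_eq_mul]
  congr 2
  rw [show (!![1, 0; 0, -1] * !![1, 0; 0, -1] : Matrix (Fin 2) (Fin 2) R) = 1 by
    ext i j
    fin_cases i <;> fin_cases j <;> simp, one_mul]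

theorem transferProd_zero_offDiag (a : ℕ → R) (n : ℕ) :
    transferProd 0 a (n + 1) = !![∏ k ∈ Finset.range (n + 1), a k, 0; 0, 0] := by
  induction n with
  | zero => simp [transferProd_succ, transferProd_zero]
  | succ n ih =>
    rw [transferProd_succ, ih, Finset.prod_range_succ _ (n + 1)]
    ext i j
    fin_cases i <;> fin_cases j <;> simp

/-- The trace of a product of matrices whose entries have degree at most `2`. -/
theorem natDegree_trace_transferProd_le (x : R[X]) (a : ℕ → R[X]) (hx : x.natDegree ≤ 2)
    (ha : ∀ k, (a k).natDegree ≤ 2) (n : ℕ) : (transferProd x a n).trace.natDegree ≤ 2 * n := by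
  have h : ∀ n, ∀ i j, (transferProd x a n i j).natDegree ≤ 2 * n := by
    intro n
    induction n with
    | zero =>
      intro i j
      fin_cases i <;> fin_cases j <;> simp [transferProd_zero]
    | succ n ih =>
      intro i j
      rw [transferProd_succ, Matrix.mul_apply, Fin.sum_univ_two]
      have hm : ∀ (k : Fin 2) (f : R[X]), f.natDegree ≤ 2 →
          (transferProd x a n i k * f).natDegree ≤ 2 * (n + 1) := fun k f hf =>
        natDegree_mul_le.trans (by have := ih i k; omega)
      refine natDegree_add_le_of_degree_le (hm _ _ ?_) (hm _ _ ?_) <;>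
        fin_cases j <;> simp [ha, hx]
  rw [Matrix.trace_fin_two]
  exact natDegree_add_le_of_degree_le (h n 0 0) (h n 1 1)

/-- The trace of a product of `n + 1` transfer matrices is monic of degree `n + 1`. -/
theorem monic_trace_transferProd [Nontrivial R] (v : ℕ → R) (n : ℕ) :
    (transferProd 1 (fun k => X - C (v k)) (n + 1)).trace.Monic ∧
      (transferProd 1 (fun k => X - C (v k)) (n + 1)).trace.natDegree = n + 1 := by
  set M := transferProd 1 (fun k => X - C (v k)) with hM
  have h00 : ∀ n, M (n + 1) 0 0 = M n 0 0 * (X - C (v n)) + M n 0 1 := by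
    intro n; simp [hM, transferProd_succ, Matrix.mul_apply]
  have h01 : ∀ n, M (n + 1) 0 1 = - M n 0 0 := by
    intro n; simp [hM, transferProd_succ, Matrix.mul_apply]
  have h10 : ∀ n, M (n + 1) 1 0 = M n 1 0 * (X - C (v n)) + M n 1 1 := by
    intro n; simp [hM, transferProd_succ, Matrix.mul_apply]
  have h11 : ∀ n, M (n + 1) 1 1 = - M n 1 0 := by
    intro n; simp [hM, transferProd_succ, Matrix.mul_apply]
  have key : ∀ n, ((M n 0 0).Monic ∧ (M n 0 0).degree = n) ∧ (M n 0 1).degree < n ∧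
      (M n 1 0).degree < n ∧ (M n 1 1).degree < ((n + 1 : ℕ) : WithBot ℕ) := by
    intro n
    induction n with
    | zero => simp [hM, transferProd_zero]
    | succ n ih =>
      obtain ⟨⟨hm, hd⟩, h1, h2, h3⟩ := ih
      have hX : (M n 0 0 * (X - C (v n))).Monic := hm.mul (monic_X_sub_C _)
      have hXd : (M n 0 0 * (X - C (v n))).degree = ((n + 1 : ℕ) : WithBot ℕ) := by
        rw [(monic_X_sub_C _).degree_mul, hd, degree_X_sub_C]; rfl
      have hlt : (M n 0 1).degree < (M n 0 0 * (X - C (v n))).degree := by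
        rw [hXd]
        exact h1.trans (by exact_mod_cast Nat.lt_succ_self n)
      rw [h00, h01, h10, h11, degree_neg, degree_neg, hd]
      refine ⟨⟨hX.add_of_left hlt, ?_⟩, ?_, ?_, ?_⟩
      · rw [degree_add_eq_left_of_degree_lt hlt, hXd]
      · exact_mod_cast Nat.lt_succ_self n
      · refine (degree_add_le _ _).trans_lt (max_lt ?_ h3)
        rw [(monic_X_sub_C _).degree_mul, degree_X_sub_C]
        push_cast
        exact WithBot.add_lt_add_right (by simp) h2
      · exact h2.trans (by exact_mod_cast (by omega : n < n + 1 + 1))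
  have hlt : (M (n + 1) 1 1).degree < (M (n + 1) 0 0).degree := by
    rw [h11, degree_neg, (key (n + 1)).1.2]
    exact (key n).2.2.1.trans (by exact_mod_cast Nat.lt_succ_self n)
  rw [Matrix.trace_fin_two]
  refine ⟨(key (n + 1)).1.1.add_of_left hlt, natDegree_eq_of_degree_eq_some ?_⟩
  rw [degree_add_eq_left_of_degree_lt hlt, (key (n + 1)).1.2]

end TransferProducts

/-- A sequence in a module on which a ring element `x` acts by the three-term recurrence
`x e_n = e_{n+1} + e_{n-1} + v_n e_n` with `q`-periodic coefficients: by the Cayley-Hamilton theorem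
for the monodromy matrix, its trace acts as `e_n ↦ e_{n+q} + e_{n-q}`. -/
theorem trace_smul_eq_of_recurrence {S N : Type*} [CommRing S] [AddCommGroup N] [Module S N]
    (x : S) (v : ℤ → S) (q : ℕ) (hv : ∀ n, v (n + q) = v n) (e : ℤ → N)
    (he : ∀ n, x • e n = e (n + 1) + e (n - 1) + v n • e n) (n : ℤ) :
    (transferProd 1 (fun k : ℕ => x - v (n + 1 + k)) q).trace • e n = e (n + q) + e (n - q) := by
  have step : ∀ (s : ℤ) (k : ℕ),
      e s = transferProd 1 (fun k : ℕ => x - v (s + 1 + k)) k 0 0 • e (s + k) +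
        transferProd 1 (fun k : ℕ => x - v (s + 1 + k)) k 0 1 • e (s + k + 1) ∧
      e (s + 1) = transferProd 1 (fun k : ℕ => x - v (s + 1 + k)) k 1 0 • e (s + k) +
        transferProd 1 (fun k : ℕ => x - v (s + 1 + k)) k 1 1 • e (s + k + 1) := by
    intro s k
    induction k with
    | zero => simp [transferProd_zero]
    | succ k ih =>
      have h := he (s + k + 1)
      have h' : e (s + k) = (x - v (s + 1 + k)) • e (s + k + 1) - e (s + k + 1 + 1) := by
        rw [show s + 1 + (k : ℤ) = s + k + 1 by ring, sub_smul, h]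
        rw [show s + (k : ℤ) + 1 - 1 = s + k by ring]
        abel
      refine ⟨ih.1.trans ?_, ih.2.trans ?_⟩ <;>
      · rw [h', transferProd_succ]
        simp only [Matrix.mul_apply, Fin.sum_univ_two]
        push_cast
        simp [show s + ((k : ℤ) + 1) = s + k + 1 by ring]
        module
  have hper : (fun k : ℕ => x - v (n - q + 1 + k)) = fun k : ℕ => x - v (n + 1 + k) := by
    funext k
    rw [← hv (n - q + 1 + k)]
    congr 2
    ring
  have h1 := (step (n - q) q).1
  obtain ⟨h2, h3⟩ := step n q
  rw [hper] at h1
  have hdet := det_transferProd (fun k : ℕ => x - v (n + 1 + k)) q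
  rw [Matrix.det_fin_two] at hdet
  rw [Matrix.trace_fin_two]
  set M := transferProd 1 (fun k : ℕ => x - v (n + 1 + k)) q
  rw [show n - (q : ℤ) + q = n by ring] at h1
  have h4 : M 1 1 • e n - M 0 1 • e (n + 1) = e (n + q) := by
    calc M 1 1 • e n - M 0 1 • e (n + 1)
        = (M 0 0 * M 1 1 - M 0 1 * M 1 0) • e (n + q) := by
          rw [h2, h3]
          module
      _ = e (n + q) := by rw [hdet, one_smul]
  rw [add_smul, h1, ← h4]
  abel

/-! ### Chambers' formula -/

/-- The trace of the product of the transfer matrices at the sites `1, …, q` for the potential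
`n ↦ 2 cos (2πnp/q + φ)`, as a polynomial in the energy. -/
noncomputable def phaseTrace (p q : ℕ) (φ : ℝ) : ℝ[X] :=
  (transferProd 1
    (fun k : ℕ => X - C (2 * Real.cos (2 * Real.pi * (((k + 1 : ℕ) : ℝ) * p / q) + φ))) q).trace

theorem discriminant_eq_neg_phaseTrace (p q : ℕ) :
    discriminant p q = -phaseTrace p q (Real.pi / (2 * q)) := rfl

theorem eval_phaseTrace (p q : ℕ) (φ E : ℝ) :
    (phaseTrace p q φ).eval E = (transferProd 1
      (fun k : ℕ => E - 2 * Real.cos (2 * Real.pi * (((k + 1 : ℕ) : ℝ) * p / q) + φ)) q).trace := by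
  have h := map_trace_transferProd (evalRingHom E) 1
    (fun k : ℕ => X - C (2 * Real.cos (2 * Real.pi * (((k + 1 : ℕ) : ℝ) * p / q) + φ))) q
  simp only [map_one, map_sub, coe_evalRingHom, eval_X, eval_C] at h
  exact h

theorem two_mul_cos_eq_exp_add_exp_inv (x : ℝ) :
    ((2 * Real.cos x : ℝ) : ℂ) = Complex.exp (x * Complex.I) + (Complex.exp (x * Complex.I))⁻¹ := by
  rw [← Complex.exp_neg]
  push_cast
  rw [Complex.two_cos, neg_mul]

/-- The primitive root of unity `exp (2πip/q)`. -/
noncomputable def fluxRoot (p q : ℕ) : ℂ := Complex.exp (2 * Real.pi * Complex.I * (p / q))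

theorem isPrimitiveRoot_fluxRoot {p q : ℕ} (hq : q ≠ 0) (hpq : Nat.Coprime p q) :
    IsPrimitiveRoot (fluxRoot p q) q :=
  Complex.isPrimitiveRoot_exp_of_coprime p q hq hpq

theorem fluxRoot_ne_zero (p q : ℕ) : fluxRoot p q ≠ 0 := Complex.exp_ne_zero _

/-- The potential in terms of `z = e^{iφ}` and `γ = exp (2πip/q)`. -/
theorem two_mul_cos_site (p q : ℕ) (φ : ℝ) (n : ℤ) :
    ((2 * Real.cos (2 * Real.pi * ((n : ℝ) * p / q) + φ) : ℝ) : ℂ) =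
      Complex.exp (φ * Complex.I) * fluxRoot p q ^ n +
        (Complex.exp (φ * Complex.I) * fluxRoot p q ^ n)⁻¹ := by
  have h : Complex.exp (φ * Complex.I) * fluxRoot p q ^ n =
      Complex.exp (((2 * Real.pi * ((n : ℝ) * p / q) + φ : ℝ) : ℂ) * Complex.I) := by
    rw [fluxRoot, ← Complex.exp_int_mul, ← Complex.exp_add]
    congr 1
    push_cast
    ring
  rw [h, two_mul_cos_eq_exp_add_exp_inv]

/-- The trace of the transfer matrices at the energy `E`, multiplied by `z ^ q`, as a polynomial in
the phase variable `z = e^{iφ}`. -/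
noncomputable def phasePoly (γ E : ℂ) (q : ℕ) : ℂ[X] :=
  (transferProd X
    (fun k => C E * X - (C (γ ^ (k + 1)) * X ^ 2 + C (γ⁻¹ ^ (k + 1)))) q).trace

theorem eval_phasePoly (γ E z : ℂ) (q : ℕ) :
    (phasePoly γ E q).eval z = (transferProd z
      (fun k => E * z - (γ ^ (k + 1) * z ^ 2 + γ⁻¹ ^ (k + 1))) q).trace := by
  have h := map_trace_transferProd (evalRingHom z) X
    (fun k => C E * X - (C (γ ^ (k + 1)) * X ^ 2 + C (γ⁻¹ ^ (k + 1)))) q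
  simp only [map_sub, map_add, map_mul, map_pow, coe_evalRingHom, eval_X, eval_C] at h
  rw [phasePoly]
  simp only [map_pow]
  exact h

theorem natDegree_phasePoly_le (γ E : ℂ) (q : ℕ) : (phasePoly γ E q).natDegree ≤ 2 * q := by
  refine natDegree_trace_transferProd_le _ _ (by simp) (fun k => ?_) q
  compute_degree

/-- The trace is invariant under a translation by one site, which multiplies `z` by `γ`. -/
theorem phasePoly_eval_mul {γ : ℂ} {q : ℕ} (E : ℂ) (hγ : γ ^ q = 1) (hq : q ≠ 0) (z : ℂ) :
    (phasePoly γ E q).eval (γ * z) = (phasePoly γ E q).eval z := by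
  have h0 : γ ≠ 0 := by
    rintro rfl
    simp [hq] at hγ
  rw [eval_phasePoly, eval_phasePoly]
  set a : ℕ → ℂ := fun k => E * z - (γ ^ (k + 1) * z ^ 2 + γ⁻¹ ^ (k + 1)) with ha
  have h1 : (fun k => E * (γ * z) - (γ ^ (k + 1) * (γ * z) ^ 2 + γ⁻¹ ^ (k + 1)))
      = fun k => γ * a (k + 1) := by
    funext k
    have : γ⁻¹ ^ (k + 1) = γ * γ⁻¹ ^ (k + 1 + 1) := by
      rw [pow_succ γ⁻¹ (k + 1)]
      field_simp
    simp only [ha]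
    rw [this]
    ring
  obtain ⟨n, rfl⟩ := Nat.exists_eq_succ_of_ne_zero hq
  rw [h1, transferProd_mul γ z (fun k => a (k + 1)), hγ, one_smul]
  refine trace_transferProd_shift z a n ?_
  have h2 : γ ^ (n + 1 + 1) = γ := by rw [pow_succ, hγ, one_mul]
  have h3 : γ⁻¹ ^ (n + 1 + 1) = γ⁻¹ := by rw [inv_pow, h2]
  simp only [ha]
  rw [h2, h3]
  simp

theorem phasePoly_coeff_eq_zero {γ : ℂ} {q : ℕ} (E : ℂ) (hγ : IsPrimitiveRoot γ q) (hq : q ≠ 0)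
    {n : ℕ} (hn : ¬ q ∣ n) : (phasePoly γ E q).coeff n = 0 := by
  have h : (phasePoly γ E q).comp (C γ * X) = phasePoly γ E q := by
    refine Polynomial.funext fun z => ?_
    rw [eval_comp, eval_mul, eval_C, eval_X, phasePoly_eval_mul E hγ.pow_eq_one hq]
  have h1 := congrArg (fun f => coeff f n) h
  simp only [comp_C_mul_X_coeff] at h1
  by_contra h2
  exact hn ((hγ.pow_eq_one_iff_dvd n).1 (mul_left_cancel₀ h2 (h1.trans (mul_one _).symm)))

theorem phasePoly_eval_eq {γ : ℂ} {q : ℕ} (E : ℂ) (hγ : IsPrimitiveRoot γ q) (hq : q ≠ 0) (z : ℂ) :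
    (phasePoly γ E q).eval z = (phasePoly γ E q).coeff 0 + (phasePoly γ E q).coeff q * z ^ q +
      (phasePoly γ E q).coeff (2 * q) * z ^ (2 * q) := by
  rw [eval_eq_sum_range' (Nat.lt_succ_of_le (natDegree_phasePoly_le γ E q))]
  have hsub : ({0, q, 2 * q} : Finset ℕ) ⊆ Finset.range (2 * q).succ := by
    intro n hn
    simp only [Finset.mem_insert, Finset.mem_singleton] at hn
    rw [Finset.mem_range]
    omega
  rw [← Finset.sum_subset hsub]
  · rw [Finset.sum_insert, Finset.sum_insert, Finset.sum_singleton]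
    · ring
    · simp only [Finset.mem_singleton]
      omega
    · simp only [Finset.mem_insert, Finset.mem_singleton]
      omega
  · intro n hn hn'
    rw [phasePoly_coeff_eq_zero E hγ hq, zero_mul]
    rintro ⟨k, rfl⟩
    rw [Finset.mem_range] at hn
    have hk : k < 3 := by
      by_contra h
      have : q * 3 ≤ q * k := Nat.mul_le_mul_left q (by omega)
      omega
    apply hn'
    simp only [Finset.mem_insert, Finset.mem_singleton]
    interval_cases k <;> omega

theorem phasePoly_coeff_zero {γ : ℂ} {q : ℕ} (E : ℂ) (hγ : γ ^ q = 1) (hodd : Odd q) :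
    (phasePoly γ E q).coeff 0 = -1 := by
  obtain ⟨m, rfl⟩ := hodd
  rw [coeff_zero_eq_eval_zero, eval_phasePoly, transferProd_zero_offDiag, Matrix.trace_fin_two]
  have hsum : ∑ k ∈ Finset.range (2 * m + 1), (k + 1) = (2 * m + 1) * (m + 1) := by
    rw [Finset.sum_add_distrib, Finset.sum_const, Finset.card_range, smul_eq_mul, mul_one]
    have h := Finset.sum_range_id_mul_two (2 * m + 1)
    simp only [Nat.add_sub_cancel] at h
    nlinarith
  have h1 : ∀ k ∈ Finset.range (2 * m + 1),
      E * 0 - (γ ^ (k + 1) * 0 ^ 2 + γ⁻¹ ^ (k + 1)) = -1 * γ⁻¹ ^ (k + 1) := by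
    intro k _
    simp
  simp only [Matrix.of_apply, Matrix.cons_val', Matrix.cons_val_zero, Matrix.cons_val_one,
    Matrix.cons_val_fin_one, add_zero]
  rw [Finset.prod_congr rfl h1, Finset.prod_mul_distrib, Finset.prod_pow_eq_pow_sum, hsum,
    Finset.prod_const, Finset.card_range, pow_mul γ⁻¹, inv_pow, hγ, inv_one, one_pow, mul_one]
  exact Odd.neg_one_pow ⟨m, rfl⟩

/-- The real trace in terms of the polynomial in `z = e^{iφ}`. -/
theorem eval_phasePoly_exp (p q : ℕ) (φ E : ℝ) :
    (phasePoly (fluxRoot p q) E q).eval (Complex.exp (φ * Complex.I)) =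
      Complex.exp (φ * Complex.I) ^ q * (((phaseTrace p q φ).eval E : ℝ) : ℂ) := by
  rw [eval_phasePoly, eval_phaseTrace]
  have h := map_trace_transferProd Complex.ofRealHom 1
    (fun k : ℕ => E - 2 * Real.cos (2 * Real.pi * (((k + 1 : ℕ) : ℝ) * p / q) + φ)) q
  rw [show ((transferProd 1 (fun k : ℕ =>
      E - 2 * Real.cos (2 * Real.pi * (((k + 1 : ℕ) : ℝ) * p / q) + φ)) q).trace : ℂ) = _ from h,
    ← smul_eq_mul (Complex.exp (φ * Complex.I) ^ q), ← Matrix.trace_smul, ← transferProd_mul]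
  have hz : Complex.exp (φ * Complex.I) ≠ 0 := Complex.exp_ne_zero _
  have hγ := fluxRoot_ne_zero p q
  congr 3
  · simp
  · funext k
    have h2 := two_mul_cos_site p q φ ((k + 1 : ℕ) : ℤ)
    rw [zpow_natCast, Int.cast_natCast] at h2
    rw [Complex.ofRealHom_eq_coe, Complex.ofReal_sub, h2, inv_pow]
    field_simp

/-- **Chambers' formula** at one energy. -/
theorem exists_eval_phaseTrace_eq {p q : ℕ} (hodd : Odd q) (hpq : Nat.Coprime p q) (E : ℝ) :
    ∃ c : ℝ, ∀ φ : ℝ, (phaseTrace p q φ).eval E = c - 2 * Real.cos (q * φ) := by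
  have hq : q ≠ 0 := by
    rintro rfl
    simp at hodd
  have hq' : (q : ℝ) ≠ 0 := Nat.cast_ne_zero.2 hq
  have hγ := isPrimitiveRoot_fluxRoot hq hpq
  set Q := phasePoly (fluxRoot p q) E q with hQ
  have h0 : Q.coeff 0 = -1 := phasePoly_coeff_zero _ hγ.pow_eq_one hodd
  have key : ∀ φ : ℝ, (((phaseTrace p q φ).eval E : ℝ) : ℂ) =
      -(Complex.exp ((q * φ : ℝ) * Complex.I))⁻¹ + Q.coeff q +
        Q.coeff (2 * q) * Complex.exp ((q * φ : ℝ) * Complex.I) := by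
    intro φ
    have h1 := eval_phasePoly_exp p q φ E
    rw [phasePoly_eval_eq _ hγ hq, ← hQ, h0] at h1
    have h2 : Complex.exp ((q * φ : ℝ) * Complex.I) = Complex.exp (φ * Complex.I) ^ q := by
      rw [← Complex.exp_nat_mul]
      push_cast
      ring_nf
    rw [h2]
    have hz : Complex.exp (φ * Complex.I) ^ q ≠ 0 := pow_ne_zero _ (Complex.exp_ne_zero _)
    rw [pow_mul'] at h1
    field_simp
    linear_combination -h1
  -- The left-hand side is real at the phases `qφ = 0, π, π/2`, which determines `Q.coeff (2 * q)`.
  have k0 := key 0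
  have k1 := key (Real.pi / q)
  have k2 := key (Real.pi / 2 / q)
  rw [mul_zero, Complex.ofReal_zero, zero_mul, Complex.exp_zero] at k0
  rw [mul_div_cancel₀ _ hq', Complex.exp_pi_mul_I] at k1
  rw [mul_div_cancel₀ _ hq', Complex.ofReal_div, Complex.ofReal_ofNat,
    Complex.exp_pi_div_two_mul_I] at k2
  have i0 := congrArg Complex.im k0
  have i1 := congrArg Complex.im k1
  have i2 := congrArg Complex.im k2
  simp only [Complex.ofReal_im, Complex.add_im, Complex.neg_im, Complex.mul_im, Complex.inv_I,
    inv_one, Complex.one_im, Complex.one_re, Complex.I_re, Complex.I_im, Complex.neg_re,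
    mul_zero, mul_one, neg_neg, inv_neg, add_zero, zero_add, neg_zero] at i0 i1 i2
  refine ⟨(Q.coeff q).re, fun φ => ?_⟩
  have k := congrArg Complex.re (key φ)
  have hexp : (Complex.exp ((q * φ : ℝ) * Complex.I))⁻¹ =
      Complex.exp (((-(q * φ) : ℝ) : ℂ) * Complex.I) := by
    rw [← Complex.exp_neg]
    push_cast
    ring_nf
  rw [hexp] at k
  simp only [Complex.ofReal_re, Complex.add_re, Complex.neg_re, Complex.mul_re,
    Complex.exp_ofReal_mul_I_re, Complex.exp_ofReal_mul_I_im, Real.cos_neg] at k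
  have e1 : (Q.coeff (2 * q)).re = -1 := by linarith
  have e2 : (Q.coeff (2 * q)).im = 0 := by linarith
  rw [e1, e2] at k
  rw [k]
  ring

/-- **Chambers' formula**: the trace depends on the phase only through an additive constant. -/
theorem phaseTrace_eq {p q : ℕ} (hodd : Odd q) (hpq : Nat.Coprime p q) (φ : ℝ) :
    phaseTrace p q φ = -discriminant p q - C (2 * Real.cos (q * φ)) := by
  refine Polynomial.funext fun E => ?_
  obtain ⟨c, hc⟩ := exists_eval_phaseTrace_eq hodd hpq E
  have hq' : (q : ℝ) ≠ 0 := Nat.cast_ne_zero.2 (by rintro rfl; simp at hodd)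
  have h : (q : ℝ) * (Real.pi / (2 * q)) = Real.pi / 2 := by field_simp
  rw [discriminant_eq_neg_phaseTrace, neg_neg, eval_sub, eval_C, hc, hc, h, Real.cos_pi_div_two]
  ring

theorem monic_neg_discriminant {p q : ℕ} (hq : q ≠ 0) : (-discriminant p q).Monic := by
  obtain ⟨n, rfl⟩ := Nat.exists_eq_succ_of_ne_zero hq
  rw [discriminant_eq_neg_phaseTrace, neg_neg]
  exact (monic_trace_transferProd _ n).1

theorem natDegree_neg_discriminant {p q : ℕ} (hq : q ≠ 0) :
    (-discriminant p q).natDegree = q := by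
  obtain ⟨n, rfl⟩ := Nat.exists_eq_succ_of_ne_zero hq
  rw [discriminant_eq_neg_phaseTrace, neg_neg]
  exact (monic_trace_transferProd _ n).2

/-- For odd `q` the discriminant is odd: a translation of the phase by `π` changes the sign of the
potential. -/
theorem eval_neg_neg_discriminant {p q : ℕ} (hodd : Odd q) (hpq : Nat.Coprime p q) (E : ℝ) :
    (-discriminant p q).eval (-E) = -(-discriminant p q).eval E := by
  have h1 := congrArg (eval E) (phaseTrace_eq hodd hpq 0)
  have h2 := congrArg (eval (-E)) (phaseTrace_eq hodd hpq Real.pi)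
  rw [eval_sub, eval_C, mul_zero, Real.cos_zero] at h1
  have h3 : Real.cos (q * Real.pi) = -1 := by
    rw [Real.cos_nat_mul_pi, hodd.neg_one_pow]
  rw [eval_sub, eval_C, h3] at h2
  rw [eval_phaseTrace] at h1 h2
  have h4 : (fun k : ℕ => -E -
      2 * Real.cos (2 * Real.pi * (((k + 1 : ℕ) : ℝ) * p / q) + Real.pi)) = fun k : ℕ =>
      -(E - 2 * Real.cos (2 * Real.pi * (((k + 1 : ℕ) : ℝ) * p / q) + 0)) := by
    funext k
    rw [Real.cos_add_pi, add_zero]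
    ring
  rw [h4, trace_transferProd_neg, hodd.neg_one_pow, h1] at h2
  linarith

/-! ### Gaussian binomial coefficients and the Harper matrix -/

/-- The Gaussian binomial coefficient `[n choose i]` at `γ`, defined by its Pascal recursion. -/
def gaussBinom (γ : ℂ) : ℕ → ℕ → ℂ
  | _, 0 => 1
  | 0, _ + 1 => 0
  | n + 1, i + 1 => gaussBinom γ n i + γ ^ (i + 1) * gaussBinom γ n (i + 1)

theorem gaussBinom_zero_right (γ : ℂ) (n : ℕ) : gaussBinom γ n 0 = 1 := by
  cases n <;> rfl

theorem gaussBinom_succ_succ (γ : ℂ) (n i : ℕ) : gaussBinom γ (n + 1) (i + 1) =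
    gaussBinom γ n i + γ ^ (i + 1) * gaussBinom γ n (i + 1) := rfl

theorem gaussBinom_eq_zero (γ : ℂ) {n i : ℕ} (h : n < i) : gaussBinom γ n i = 0 := by
  induction n generalizing i with
  | zero =>
    obtain ⟨i, rfl⟩ := Nat.exists_eq_succ_of_ne_zero (by omega : i ≠ 0)
    rfl
  | succ n ih =>
    obtain ⟨i, rfl⟩ := Nat.exists_eq_succ_of_ne_zero (by omega : i ≠ 0)
    rw [gaussBinom_succ_succ, ih (by omega), ih (by omega)]
    ring

theorem gaussBinom_mul (γ : ℂ) (n : ℕ) : ∀ i j, i + j = n →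
    gaussBinom γ n i * (1 - γ ^ j) = gaussBinom γ n (i + 1) * (1 - γ ^ (i + 1)) := by
  induction n with
  | zero =>
    intro i j h
    obtain ⟨rfl, rfl⟩ : i = 0 ∧ j = 0 := by omega
    simp [gaussBinom]
  | succ n ih =>
    intro i j h
    rcases i with _ | i
    · obtain rfl : j = n + 1 := by omega
      have := ih 0 n (by omega)
      rw [gaussBinom_zero_right] at this
      rw [gaussBinom_zero_right, gaussBinom_succ_succ, gaussBinom_zero_right]
      linear_combination γ * this
    · rcases j with _ | j
      · rw [gaussBinom_eq_zero γ (by omega : n + 1 < i + 1 + 1)]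
        simp
      · obtain rfl : n = i + (j + 1) := by omega
        have h1 := ih i (j + 1) rfl
        have h2 := ih (i + 1) j (by omega)
        rw [gaussBinom_succ_succ, gaussBinom_succ_succ]
        linear_combination h1 + γ ^ (i + 2) * h2

/-- At a primitive `q`-th root of unity the coefficients `[q - 1 choose i]` have modulus one. -/
theorem norm_gaussBinom {γ : ℂ} {n : ℕ} (hγ : IsPrimitiveRoot γ (n + 1)) {i : ℕ} (hi : i ≤ n) :
    ‖gaussBinom γ n i‖ = 1 := by
  have hn : ‖γ‖ = 1 := hγ.norm'_eq_one (by omega)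
  induction i with
  | zero => rw [gaussBinom_zero_right, norm_one]
  | succ i ih =>
    have h := gaussBinom_mul γ n i (n - i) (by omega)
    have h1 : γ ^ (n - i) * γ ^ (i + 1) = 1 := by
      rw [← pow_add, show n - i + (i + 1) = n + 1 by omega, hγ.pow_eq_one]
    have h2 : 1 - γ ^ (i + 1) ≠ 0 :=
      sub_ne_zero.2 (Ne.symm (hγ.pow_ne_one_of_pos_of_lt (by omega) (by omega)))
    have h3 : gaussBinom γ n (i + 1) * γ ^ (i + 1) = -gaussBinom γ n i := by
      refine mul_right_cancel₀ h2 ?_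
      linear_combination (-γ ^ (i + 1)) * h + gaussBinom γ n i * (-h1)
    have h4 := congrArg norm h3
    rw [norm_mul, norm_pow, hn, one_pow, mul_one, norm_neg, ih (by omega)] at h4
    exact h4

section WeylMatrices

variable {q : ℕ}

/-- The product `Sⁱ Uʲ` of powers of the cyclic shift `S` and of the diagonal matrix `U` with
entries `u b`. -/
noncomputable def weylMatrix (u : ZMod q → ℂ) (i j : ℤ) : Matrix (ZMod q) (ZMod q) ℂ :=
  Matrix.of fun a b => if a = b + (i : ZMod q) then u b ^ j else 0

/-- The Harper matrix `S + S⁻¹ + U + U⁻¹`: the almost Mathieu operator on `q`-periodic sequences. -/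
noncomputable def harperMatrix (u : ZMod q → ℂ) : Matrix (ZMod q) (ZMod q) ℂ :=
  weylMatrix u 1 0 + weylMatrix u 0 1 + (weylMatrix u (-1) 0 + weylMatrix u 0 (-1))

theorem weylMatrix_apply (u : ZMod q → ℂ) (i j : ℤ) (a b : ZMod q) :
    weylMatrix u i j a b = if a = b + (i : ZMod q) then u b ^ j else 0 := rfl

theorem weylMatrix_zero (u : ZMod q → ℂ) : weylMatrix u 0 0 = 1 := by
  ext a b
  simp [weylMatrix_apply, Matrix.one_apply]

variable {γ : ℂ} {u : ZMod q → ℂ}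

theorem apply_add_int (hγ : γ ≠ 0) (hu : ∀ b, u (b + 1) = γ * u b) (b : ZMod q) (k : ℤ) :
    u (b + (k : ZMod q)) = γ ^ k * u b := by
  induction k with
  | zero => simp
  | succ k ih =>
    rw [zpow_add_one₀ hγ, Int.cast_add, Int.cast_one, ← add_assoc, hu, ih]
    ring
  | pred k ih =>
    have h := hu (b + ((-(k : ℤ) - 1 : ℤ) : ZMod q))
    rw [add_assoc, show ((-(k : ℤ) - 1 : ℤ) : ZMod q) + 1 = ((-(k : ℤ) : ℤ) : ZMod q) by
      push_cast; ring, ih] at h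
    rw [zpow_sub_one₀ hγ]
    field_simp
    linear_combination -h

/-- The span of the `Sⁱ Uʲ` with `|i| + |j| ≤ n` and `i + j ≤ s`. -/
noncomputable def weylSpan (u : ZMod q → ℂ) (n s : ℤ) :
    Submodule ℂ (Matrix (ZMod q) (ZMod q) ℂ) :=
  Submodule.span ℂ {A | ∃ i j : ℤ, |i| + |j| ≤ n ∧ i + j ≤ s ∧ A = weylMatrix u i j}

theorem weylMatrix_mem_weylSpan (u : ZMod q → ℂ) {n s i j : ℤ} (h : |i| + |j| ≤ n)
    (h' : i + j ≤ s) : weylMatrix u i j ∈ weylSpan u n s :=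
  Submodule.subset_span ⟨i, j, h, h', rfl⟩

theorem weylSpan_mono (u : ZMod q → ℂ) {n s n' s' : ℤ} (h : n ≤ n') (h' : s ≤ s') :
    weylSpan u n s ≤ weylSpan u n' s' := by
  refine Submodule.span_mono ?_
  rintro A ⟨i, j, h1, h2, rfl⟩
  exact ⟨i, j, h1.trans h, h2.trans h', rfl⟩

theorem isHermitian_harperMatrix (hu1 : ∀ b, ‖u b‖ = 1) : (harperMatrix u).IsHermitian := by
  have hs : ∀ b, star (u b) = (u b)⁻¹ := fun b => (Complex.inv_eq_conj (hu1 b)).symm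
  have h1 : (weylMatrix u 1 0).conjTranspose = weylMatrix u (-1) 0 := by
    ext a b
    rw [Matrix.conjTranspose_apply, weylMatrix_apply, weylMatrix_apply]
    have : b = a + ((1 : ℤ) : ZMod q) ↔ a = b + ((-1 : ℤ) : ZMod q) := by
      push_cast
      constructor <;> (rintro rfl; ring)
    simp only [this, apply_ite star, zpow_zero, star_one, star_zero]
  have h2 : (weylMatrix u 0 1).conjTranspose = weylMatrix u 0 (-1) := by
    ext a b
    rw [Matrix.conjTranspose_apply, weylMatrix_apply, weylMatrix_apply]
    by_cases h : a = b
    · subst h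
      simp [hs]
    · simp [h, Ne.symm h]
  have h3 : (weylMatrix u (-1) 0).conjTranspose = weylMatrix u 1 0 := by
    rw [← h1, Matrix.conjTranspose_conjTranspose]
  have h4 : (weylMatrix u 0 (-1)).conjTranspose = weylMatrix u 0 1 := by
    rw [← h2, Matrix.conjTranspose_conjTranspose]
  rw [Matrix.IsHermitian, harperMatrix, Matrix.conjTranspose_add, Matrix.conjTranspose_add,
    Matrix.conjTranspose_add, h1, h2, h3, h4]
  abel

variable [NeZero q]

theorem weylMatrix_mul (hγ : γ ≠ 0) (hu : ∀ b, u (b + 1) = γ * u b) (hu0 : ∀ b, u b ≠ 0)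
    (i j k l : ℤ) : weylMatrix u i j * weylMatrix u k l =
      γ ^ (k * j) • weylMatrix u (i + k) (j + l) := by
  ext a c
  rw [Matrix.mul_apply, Matrix.smul_apply, Finset.sum_eq_single (c + (k : ZMod q))]
  · rw [weylMatrix_apply, weylMatrix_apply, weylMatrix_apply, if_pos rfl]
    have h : a = c + (k : ZMod q) + (i : ZMod q) ↔ a = c + ((i + k : ℤ) : ZMod q) := by
      push_cast
      rw [add_assoc, add_comm (k : ZMod q)]
    simp only [h]
    split_ifs
    · rw [apply_add_int hγ hu, mul_zpow, zpow_add₀ (hu0 c), smul_eq_mul, zpow_mul]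
      ring
    · simp
  · intro b _ hb
    rw [weylMatrix_apply u k, if_neg hb, mul_zero]
  · simp

/-- The coefficient functional of `S^m U^m`, up to the factor `q`. -/
noncomputable def weylCoeff (u : ZMod q → ℂ) (m : ℕ) :
    Matrix (ZMod q) (ZMod q) ℂ →ₗ[ℂ] ℂ where
  toFun A := ∑ b, (u b ^ m)⁻¹ * A (b + (m : ZMod q)) b
  map_add' A B := by simp [mul_add, Finset.sum_add_distrib]
  map_smul' c A := by simp [Finset.mul_sum, mul_left_comm]

theorem weylCoeff_apply (u : ZMod q → ℂ) (m : ℕ) (A : Matrix (ZMod q) (ZMod q) ℂ) :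
    weylCoeff u m A = ∑ b, (u b ^ m)⁻¹ * A (b + (m : ZMod q)) b := rfl

theorem weylCoeff_self (hu0 : ∀ b, u b ≠ 0) (m : ℕ) :
    weylCoeff u m (weylMatrix u m m) = q := by
  rw [weylCoeff_apply]
  have h : ∀ b ∈ (Finset.univ : Finset (ZMod q)),
      (u b ^ m)⁻¹ * weylMatrix u m m (b + (m : ZMod q)) b = 1 := by
    intro b _
    rw [weylMatrix_apply, if_pos (by simp), zpow_natCast]
    exact inv_mul_cancel₀ (pow_ne_zero _ (hu0 b))
  rw [Finset.sum_congr rfl h]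
  simp [ZMod.card]

/-- The matrices `Sⁱ Uʲ` with different classes of `(i, j)` modulo `q` are orthogonal. -/
theorem weylCoeff_eq_zero (hγ : IsPrimitiveRoot γ q) (hu : ∀ b, u (b + 1) = γ * u b)
    (hu0 : ∀ b, u b ≠ 0) {m : ℕ} {i j : ℤ} (h : ¬ ((q : ℤ) ∣ i - m ∧ (q : ℤ) ∣ j - m)) :
    weylCoeff u m (weylMatrix u i j) = 0 := by
  rw [weylCoeff_apply]
  by_cases hi : (q : ℤ) ∣ i - m
  · have hj : ¬ (q : ℤ) ∣ j - m := fun hj => h ⟨hi, hj⟩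
    have hi' : ((m : ℕ) : ZMod q) = ((i : ℤ) : ZMod q) := by
      rw [← sub_eq_zero, ← neg_eq_zero, neg_sub]
      exact_mod_cast (ZMod.intCast_zmod_eq_zero_iff_dvd (i - m) q).2 hi
    have h1 : ∀ b, (u b ^ m)⁻¹ * weylMatrix u i j (b + (m : ZMod q)) b = u b ^ (j - m) := by
      intro b
      rw [weylMatrix_apply, hi', if_pos rfl, zpow_sub₀ (hu0 b), zpow_natCast, div_eq_inv_mul]
    simp only [h1]
    have h2 : ∑ b, u b ^ (j - m) = γ ^ (j - m) * ∑ b, u b ^ (j - m) := by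
      rw [Finset.mul_sum, ← Equiv.sum_comp (Equiv.addRight (1 : ZMod q))]
      refine Finset.sum_congr rfl fun b _ => ?_
      rw [Equiv.coe_addRight, hu, mul_zpow]
    have h3 : γ ^ (j - m) ≠ 1 := fun h => hj ((hγ.zpow_eq_one_iff_dvd _).1 h)
    have h4 : (1 - γ ^ (j - m)) * ∑ b, u b ^ (j - m) = 0 := by linear_combination h2
    exact (mul_eq_zero.1 h4).resolve_left (sub_ne_zero.2 (Ne.symm h3))
  · refine Finset.sum_eq_zero fun b _ => ?_
    rw [weylMatrix_apply, if_neg, mul_zero]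
    intro h1
    apply hi
    rw [← ZMod.intCast_zmod_eq_zero_iff_dvd]
    push_cast
    rw [← add_left_cancel h1, sub_self]

theorem weylMatrix_mul_mem (hγ : γ ≠ 0) (hu : ∀ b, u (b + 1) = γ * u b) (hu0 : ∀ b, u b ≠ 0)
    {A : Matrix (ZMod q) (ZMod q) ℂ} {n s : ℤ} (hA : A ∈ weylSpan u n s) {k l n' s' : ℤ}
    (h : |k| + |l| ≤ n') (h' : k + l ≤ s') : weylMatrix u k l * A ∈ weylSpan u (n' + n) (s' + s) := by
  induction hA using Submodule.span_induction with
  | mem A hA =>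
    obtain ⟨i, j, h1, h2, rfl⟩ := hA
    rw [weylMatrix_mul hγ hu hu0]
    refine Submodule.smul_mem _ _ (weylMatrix_mem_weylSpan u ?_ (by omega))
    have := abs_add_le k i
    have := abs_add_le l j
    omega
  | zero => rw [mul_zero]; exact Submodule.zero_mem _
  | add A B _ _ hA hB => rw [mul_add]; exact Submodule.add_mem _ hA hB
  | smul c A _ hA => rw [Matrix.mul_smul]; exact Submodule.smul_mem _ _ hA

/-- The noncommutative binomial theorem for `S + U`. -/
theorem add_pow_weylMatrix (hγ : γ ≠ 0) (hu : ∀ b, u (b + 1) = γ * u b) (hu0 : ∀ b, u b ≠ 0)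
    (n : ℕ) : (weylMatrix u 1 0 + weylMatrix u 0 1) ^ n =
      ∑ i ∈ Finset.range (n + 1), gaussBinom γ n i • weylMatrix u i ((n : ℤ) - i) := by
  induction n with
  | zero => simp [gaussBinom, weylMatrix_zero]
  | succ n ih =>
    have h1 : ∀ i : ℕ, (weylMatrix u 1 0 + weylMatrix u 0 1) *
        (gaussBinom γ n i • weylMatrix u i ((n : ℤ) - i)) =
        gaussBinom γ n i • weylMatrix u ((i : ℤ) + 1) ((n : ℤ) - i) +
          (γ ^ i * gaussBinom γ n i) • weylMatrix u i ((n : ℤ) + 1 - i) := by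
      intro i
      rw [Matrix.mul_smul, add_mul, weylMatrix_mul hγ hu hu0, weylMatrix_mul hγ hu hu0, mul_zero,
        mul_one, zpow_zero, one_smul, smul_add, smul_smul, zpow_natCast, zero_add, zero_add,
        add_comm (1 : ℤ), mul_comm (gaussBinom γ n i),
        show 1 + ((n : ℤ) - i) = (n : ℤ) + 1 - i by ring]
    rw [pow_succ', ih, Finset.mul_sum, Finset.sum_congr rfl fun i _ => h1 i,
      Finset.sum_add_distrib, Finset.sum_range_succ' _ (n + 1),
      Finset.sum_range_succ' (fun i : ℕ =>
        (γ ^ i * gaussBinom γ n i) • weylMatrix u i ((n : ℤ) + 1 - i)) n, ← add_assoc]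
    have h2 : ∑ i ∈ Finset.range (n + 1),
        gaussBinom γ (n + 1) (i + 1) • weylMatrix u ((i + 1 : ℕ) : ℤ) (((n + 1 : ℕ) : ℤ) - (i + 1 : ℕ))
        = ∑ i ∈ Finset.range (n + 1), gaussBinom γ n i • weylMatrix u ((i : ℤ) + 1) ((n : ℤ) - i) +
          ∑ i ∈ Finset.range (n + 1), (γ ^ (i + 1) * gaussBinom γ n (i + 1)) •
            weylMatrix u ((i + 1 : ℕ) : ℤ) ((n : ℤ) + 1 - (i + 1 : ℕ)) := by
      rw [← Finset.sum_add_distrib]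
      refine Finset.sum_congr rfl fun i _ => ?_
      rw [gaussBinom_succ_succ, add_smul]
      push_cast
      rw [show (n : ℤ) + 1 - (i + 1) = n - i by ring]
    rw [h2, Finset.sum_range_succ (fun i : ℕ => (γ ^ (i + 1) * gaussBinom γ n (i + 1)) •
            weylMatrix u ((i + 1 : ℕ) : ℤ) ((n : ℤ) + 1 - (i + 1 : ℕ))) n,
      gaussBinom_eq_zero γ (Nat.lt_succ_self n), mul_zero, zero_smul, add_zero,
      gaussBinom_zero_right, gaussBinom_zero_right]
    simp

theorem add_pow_mem_weylSpan (hγ : γ ≠ 0) (hu : ∀ b, u (b + 1) = γ * u b) (hu0 : ∀ b, u b ≠ 0)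
    (n : ℕ) : (weylMatrix u 1 0 + weylMatrix u 0 1) ^ n ∈ weylSpan u n n := by
  rw [add_pow_weylMatrix hγ hu hu0]
  refine Submodule.sum_mem _ fun i hi => Submodule.smul_mem _ _ (weylMatrix_mem_weylSpan u ?_ ?_)
  · rw [Finset.mem_range] at hi
    rw [abs_of_nonneg (by omega), abs_of_nonneg (by omega)]
    omega
  · omega

/-- Every word in `S^{±1}, U^{±1}` of length `n` that is not a word in `S, U` alone contributes
`Sⁱ Uʲ` with `i + j ≤ n - 2`. -/
theorem harperMatrix_pow_sub_mem (hγ : γ ≠ 0) (hu : ∀ b, u (b + 1) = γ * u b)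
    (hu0 : ∀ b, u b ≠ 0) (n : ℕ) :
    harperMatrix u ^ n - (weylMatrix u 1 0 + weylMatrix u 0 1) ^ n ∈ weylSpan u n (n - 2) := by
  induction n with
  | zero => simp
  | succ n ih =>
    set a := weylMatrix u 1 0 + weylMatrix u 0 1 with ha
    set a' := weylMatrix u (-1) 0 + weylMatrix u 0 (-1) with ha'
    set x := harperMatrix u ^ n - a ^ n with hx
    have hh : harperMatrix u = a + a' := rfl
    have e : harperMatrix u ^ (n + 1) - a ^ (n + 1) = a * x + a' * x + a' * a ^ n := by
      rw [pow_succ', pow_succ', hx, hh]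
      noncomm_ring
    have hp := add_pow_mem_weylSpan hγ hu hu0 n
    have hmono : weylSpan u (1 + n) (1 + (n - 2)) ≤ weylSpan u ((n + 1 : ℕ) : ℤ) ((n + 1 : ℕ) - 2) :=
      weylSpan_mono u (by push_cast; omega) (by push_cast; omega)
    have hmono' : weylSpan u (1 + n) (-1 + n) ≤ weylSpan u ((n + 1 : ℕ) : ℤ) ((n + 1 : ℕ) - 2) :=
      weylSpan_mono u (by push_cast; omega) (by push_cast; omega)
    rw [e, ha, ha', add_mul, add_mul, add_mul]
    refine Submodule.add_mem _ (Submodule.add_mem _ (Submodule.add_mem _ ?_ ?_)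
      (Submodule.add_mem _ ?_ ?_)) (Submodule.add_mem _ ?_ ?_)
    · exact hmono (weylMatrix_mul_mem hγ hu hu0 ih (by simp) (by simp))
    · exact hmono (weylMatrix_mul_mem hγ hu hu0 ih (by simp) (by simp))
    · exact hmono (weylMatrix_mul_mem hγ hu hu0 ih (by simp) (by simp))
    · exact hmono (weylMatrix_mul_mem hγ hu hu0 ih (by simp) (by simp))
    · exact hmono' (weylMatrix_mul_mem hγ hu hu0 hp (by simp) (by simp))
    · exact hmono' (weylMatrix_mul_mem hγ hu hu0 hp (by simp) (by simp))

/-- For `q = 2m + 1` no `(i, j)` congruent to `(m, m)` modulo `q` is shorter than `(m, m)`, which is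
the only one of its length. -/
theorem weylCoeff_eq_zero_of_mem {m : ℕ} (hq : q = 2 * m + 1) (hγ : IsPrimitiveRoot γ q)
    (hu : ∀ b, u (b + 1) = γ * u b) (hu0 : ∀ b, u b ≠ 0) {n s : ℤ} (hn : n ≤ 2 * m)
    (hs : s < 2 * m) {A : Matrix (ZMod q) (ZMod q) ℂ} (hA : A ∈ weylSpan u n s) :
    weylCoeff u m A = 0 := by
  induction hA using Submodule.span_induction with
  | mem A hA =>
    obtain ⟨i, j, h1, h2, rfl⟩ := hA
    refine weylCoeff_eq_zero hγ hu hu0 ?_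
    rintro ⟨⟨k, hk⟩, l, hl⟩
    have hb : ∀ (x k : ℤ), |x| ≤ 2 * m → x - m = (q : ℤ) * k → k = 0 ∨ k = -1 := by
      intro x k hx hxk
      rw [hq] at hxk
      push_cast at hxk
      have h3 := abs_le.1 hx
      have h4 : k < 1 := by nlinarith
      have h5 : -2 < k := by nlinarith
      omega
    have hi := hb i k (by have := abs_nonneg j; omega) hk
    have hj := hb j l (by have := abs_nonneg i; omega) hl
    have hq' : (q : ℤ) = 2 * m + 1 := by exact_mod_cast hq
    have e1 := neg_abs_le i
    have e2 := neg_abs_le j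
    have e3 := le_abs_self i
    have e4 := le_abs_self j
    rcases hi with rfl | rfl <;> rcases hj with rfl | rfl <;> omega
  | zero => exact map_zero _
  | add A B _ _ hA hB => rw [map_add, hA, hB, add_zero]
  | smul c A _ hA => rw [map_smul, hA, smul_zero]

theorem weylCoeff_harperMatrix_pow {m : ℕ} (hq : q = 2 * m + 1) (hγ : IsPrimitiveRoot γ q)
    (hu : ∀ b, u (b + 1) = γ * u b) (hu0 : ∀ b, u b ≠ 0) {n : ℕ} (hn : n < 2 * m) :
    weylCoeff u m (harperMatrix u ^ n) = 0 := by
  have hγ0 : γ ≠ 0 := hγ.ne_zero (NeZero.ne q)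
  refine weylCoeff_eq_zero_of_mem hq hγ hu hu0 (n := n) (s := n) (by omega) (by omega) ?_
  have h := Submodule.add_mem _
    (weylSpan_mono u le_rfl (by omega) (harperMatrix_pow_sub_mem hγ0 hu hu0 n))
    (add_pow_mem_weylSpan hγ0 hu hu0 n)
  rwa [sub_add_cancel] at h

theorem norm_weylCoeff_harperMatrix_pow {m : ℕ} (hq : q = 2 * m + 1) (hγ : IsPrimitiveRoot γ q)
    (hu : ∀ b, u (b + 1) = γ * u b) (hu0 : ∀ b, u b ≠ 0) :
    ‖weylCoeff u m (harperMatrix u ^ (2 * m))‖ = q := by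
  have hγ0 : γ ≠ 0 := hγ.ne_zero (NeZero.ne q)
  have h := weylCoeff_eq_zero_of_mem hq hγ hu hu0 (by push_cast; omega) (by push_cast; omega)
    (harperMatrix_pow_sub_mem hγ0 hu hu0 (2 * m))
  rw [map_sub, sub_eq_zero] at h
  rw [h, add_pow_weylMatrix hγ0 hu hu0, map_sum, Finset.sum_eq_single m]
  · rw [map_smul, show (((2 * m : ℕ) : ℤ) - m) = m by push_cast; ring, weylCoeff_self hu0,
      smul_eq_mul, norm_mul, norm_gaussBinom (hq ▸ hγ) (by omega), one_mul, Complex.norm_natCast]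
  · intro i hi him
    rw [Finset.mem_range] at hi
    rw [map_smul, weylCoeff_eq_zero hγ hu hu0, smul_zero]
    rintro ⟨⟨k, hk⟩, -⟩
    rw [hq] at hk
    push_cast at hk
    have h4 : k < 1 := by nlinarith
    have h5 : -1 < k := by nlinarith
    obtain rfl : k = 0 := by omega
    omega
  · intro h
    exact absurd (Finset.mem_range.2 (by omega)) h

/-- A monic polynomial of degree `q - 1` in the Harper matrix has a coefficient of modulus one. -/
theorem norm_weylCoeff_aeval {m : ℕ} (hq : q = 2 * m + 1) (hγ : IsPrimitiveRoot γ q)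
    (hu : ∀ b, u (b + 1) = γ * u b) (hu0 : ∀ b, u b ≠ 0) {g : ℂ[X]} (hg : g.Monic)
    (hd : g.natDegree = 2 * m) : ‖weylCoeff u m (aeval (harperMatrix u) g)‖ = q := by
  rw [aeval_eq_sum_range, hd, map_sum, Finset.sum_range_succ, Finset.sum_eq_zero, zero_add, ← hd,
    hg.coeff_natDegree, one_smul, hd, norm_weylCoeff_harperMatrix_pow hq hγ hu hu0]
  intro n hn
  rw [map_smul, weylCoeff_harperMatrix_pow hq hγ hu hu0 (Finset.mem_range.1 hn), smul_zero]

end WeylMatrices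

/-! ### The zeros of the levels of the discriminant -/

/-- The potential at the site `n` for the frequency `p/q` and the phase `φ` (in radians). -/
noncomputable def sitePotential (p q : ℕ) (φ : ℝ) (n : ℤ) : ℝ :=
  2 * Real.cos (2 * Real.pi * ((n : ℝ) * p / q) + φ)

theorem sitePotential_add (p : ℕ) {q : ℕ} (hq : q ≠ 0) (φ : ℝ) (n : ℤ) :
    sitePotential p q φ (n + q) = sitePotential p q φ n := by
  have hq' : (q : ℝ) ≠ 0 := Nat.cast_ne_zero.2 hq
  rw [sitePotential, sitePotential, ← Real.cos_add_nat_mul_two_pi (2 * Real.pi * ((n : ℝ) * p / q) + φ) p]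
  congr 2
  push_cast
  field_simp
  ring

theorem map_trace_sitePotential {p q : ℕ} (hodd : Odd q) (hpq : Nat.Coprime p q) (φ : ℝ) (n : ℤ) :
    (transferProd 1 (fun k : ℕ => X - C ((sitePotential p q φ (n + 1 + k) : ℝ) : ℂ)) q).trace =
      (-discriminant p q - C (2 * Real.cos (q * φ))).map (algebraMap ℝ ℂ) := by
  have hq' : (q : ℝ) ≠ 0 := Nat.cast_ne_zero.2 (by rintro rfl; simp at hodd)
  have h1 : Real.cos (q * (2 * Real.pi * (n * p / q) + φ)) = Real.cos (q * φ) := by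
    rw [← Real.cos_add_int_mul_two_pi (q * φ) (n * p)]
    congr 1
    push_cast
    field_simp
    ring
  rw [← h1, ← phaseTrace_eq hodd hpq, phaseTrace, ← coe_mapRingHom, map_trace_transferProd]
  congr 2
  · simp
  · funext k
    simp only [coe_mapRingHom, Polynomial.map_sub, map_X, map_C, sitePotential]
    congr 3
    rw [Algebra.algebraMap_self_apply]
    congr 2
    push_cast
    ring

/-- If `H e_n = e_{n+1} + e_{n-1} + v_n e_n` with the almost Mathieu potential, then the
discriminant of `H` acts by translations: the magic formula together with Chambers' formula. -/
theorem aeval_neg_discriminant_smul {p q : ℕ} (hodd : Odd q) (hpq : Nat.Coprime p q) (φ : ℝ)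
    {A N : Type*} [Ring A] [Algebra ℂ A] [AddCommGroup N] [Module A N] (H : A) (e : ℤ → N)
    (he : ∀ n, H • e n = e (n + 1) + e (n - 1) +
      algebraMap ℂ A ((sitePotential p q φ n : ℝ) : ℂ) • e n) (n : ℤ) :
    aeval H ((-discriminant p q - C (2 * Real.cos (q * φ))).map (algebraMap ℝ ℂ)) • e n =
      e (n + q) + e (n - q) := by
  have hq : q ≠ 0 := by
    rintro rfl
    simp at hodd
  let _ : Module ℂ[X] N := Module.compHom N (aeval H : ℂ[X] →ₐ[ℂ] A).toRingHom
  have hs : ∀ (f : ℂ[X]) (x : N), f • x = aeval H f • x := fun _ _ => rfl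
  have h := trace_smul_eq_of_recurrence (X : ℂ[X])
    (fun n => C ((sitePotential p q φ n : ℝ) : ℂ)) q
    (fun n => by simp only [sitePotential_add p hq]) e
    (fun n => by rw [hs, hs, aeval_X, aeval_C, he]) n
  rwa [map_trace_sitePotential hodd hpq, hs] at h

section Spectral

variable {ι : Type*} [Fintype ι] [DecidableEq ι] {A : Matrix ι ι ℂ}

theorem aeval_diagonal (d : ι → ℂ) (g : ℂ[X]) :
    aeval (Matrix.diagonal d) g = Matrix.diagonal fun i => g.eval (d i) := by
  have h := aeval_algHom_apply (Matrix.diagonalAlgHom (n := ι) (α := ℂ) ℂ) d g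
  rw [Matrix.diagonalAlgHom_apply, Matrix.diagonalAlgHom_apply] at h
  rw [h]
  congr 1
  funext i
  have h2 := aeval_algHom_apply (Pi.evalAlgHom ℂ (fun _ : ι => ℂ) i) d g
  rw [Pi.evalAlgHom_apply, Pi.evalAlgHom_apply] at h2
  rw [← h2, coe_aeval_eq_eval]

theorem aeval_isHermitian (hA : A.IsHermitian) (g : ℂ[X]) :
    aeval A g = (hA.eigenvectorUnitary : Matrix ι ι ℂ) *
      Matrix.diagonal (fun i => g.eval ((hA.eigenvalues i : ℝ) : ℂ)) *
      star (hA.eigenvectorUnitary : Matrix ι ι ℂ) := by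
  have h := aeval_algHom_apply (Unitary.conjStarAlgAut ℂ (Matrix ι ι ℂ) hA.eigenvectorUnitary)
    (Matrix.diagonal (RCLike.ofReal ∘ hA.eigenvalues)) g
  rw [← hA.spectral_theorem, aeval_diagonal, Unitary.conjStarAlgAut_apply] at h
  exact h

theorem aeval_eq_zero_iff_eigenvalues (hA : A.IsHermitian) (g : ℂ[X]) :
    aeval A g = 0 ↔ ∀ i, g.eval ((hA.eigenvalues i : ℝ) : ℂ) = 0 := by
  rw [aeval_isHermitian hA]
  constructor
  · intro h i
    have hU := Unitary.coe_star_mul_self hA.eigenvectorUnitary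
    have h2 := congrArg (fun B => star (hA.eigenvectorUnitary : Matrix ι ι ℂ) * B *
      (hA.eigenvectorUnitary : Matrix ι ι ℂ)) h
    simp only [mul_zero, zero_mul] at h2
    rw [← Matrix.mul_assoc, ← Matrix.mul_assoc, hU, Matrix.one_mul, Matrix.mul_assoc, hU,
      Matrix.mul_one, Matrix.diagonal_eq_zero] at h2
    exact congrFun h2 i
  · intro h
    simp [h]

/-- If `g` vanishes at all eigenvalues but one, the entries of `g(A)` are at most the remaining
value of `g`. -/
theorem norm_aeval_apply_le (hA : A.IsHermitian) (g : ℂ[X]) (i₀ : ι)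
    (hg : ∀ i, i ≠ i₀ → g.eval ((hA.eigenvalues i : ℝ) : ℂ) = 0) (a b : ι) :
    ‖aeval A g a b‖ ≤ ‖g.eval ((hA.eigenvalues i₀ : ℝ) : ℂ)‖ := by
  have hU := entry_norm_bound_of_unitary hA.eigenvectorUnitary.2
  rw [aeval_isHermitian hA, Matrix.mul_apply, Finset.sum_eq_single i₀]
  · rw [Matrix.mul_diagonal, Matrix.star_apply, norm_mul, norm_mul, norm_star]
    calc _ ≤ 1 * ‖g.eval ((hA.eigenvalues i₀ : ℝ) : ℂ)‖ * 1 := by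
          gcongr
          · exact hU a i₀
          · exact hU b i₀
      _ = _ := by ring
  · intro i _ hi
    rw [Matrix.mul_diagonal, hg i hi]
    simp
  · simp

end Spectral

theorem eval_derivative_prod_X_sub_C {s : Finset ℝ} {x : ℝ} (hx : x ∈ s) :
    (derivative (∏ y ∈ s, (X - C y))).eval x = ∏ y ∈ s.erase x, (x - y) := by
  rw [← Finset.mul_prod_erase s _ hx, derivative_mul, derivative_X_sub_C]
  simp [eval_prod]

/-- The levels `2 + 2 cos (qφ)` of the polynomial `-σ` are attained at `q` distinct real points, the
eigenvalues of a Harper matrix, with derivative at least one there. The reason is that a monic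
polynomial of degree `q - 1` in the Harper matrix has a coefficient of modulus one. -/
theorem exists_level_roots {p q : ℕ} (hodd : Odd q) (hpq : Nat.Coprime p q) (φ : ℝ) :
    ∃ s : Finset ℝ, s.card = q ∧
      -discriminant p q - C (2 + 2 * Real.cos (q * φ)) = ∏ x ∈ s, (X - C x) ∧
      ∀ x ∈ s, 1 ≤ |(derivative (-discriminant p q)).eval x| ∧
        ∃ f : ℤ → ℂ, f ≠ 0 ∧ (∀ n, f (n + q) = f n) ∧
          ∀ n, f (n + 1) + f (n - 1) + ((sitePotential p q φ n : ℝ) : ℂ) * f n = x * f n := by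
  obtain ⟨m, hm⟩ := id hodd
  have hq0 : q ≠ 0 := by omega
  have : NeZero q := ⟨hq0⟩
  set γ := fluxRoot p q with hγdef
  have hγ : IsPrimitiveRoot γ q := isPrimitiveRoot_fluxRoot hq0 hpq
  have hγ0 : γ ≠ 0 := fluxRoot_ne_zero p q
  set z := Complex.exp (φ * Complex.I) with hz
  set u : ZMod q → ℂ := fun b => z * AddChar.zmodChar q hγ.pow_eq_one b with hu_def
  have hz1 : ‖z‖ = 1 := Complex.norm_exp_ofReal_mul_I φ
  have hγ1 : ‖γ‖ = 1 := hγ.norm'_eq_one hq0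
  have hu1 : ∀ b, ‖u b‖ = 1 := by
    intro b
    simp [hu_def, AddChar.zmodChar_apply, hz1, hγ1]
  have hu0 : ∀ b, u b ≠ 0 := fun b h => by simpa [h] using hu1 b
  have hu : ∀ b, u (b + 1) = γ * u b := by
    intro b
    have h1 : AddChar.zmodChar q hγ.pow_eq_one (1 : ZMod q) = γ := by
      simpa using AddChar.zmodChar_apply' hγ.pow_eq_one 1
    simp only [hu_def, AddChar.map_add_eq_mul, h1]
    ring
  have hun : ∀ n : ℤ, u (n : ZMod q) = z * γ ^ n := by
    intro n
    have h := apply_add_int hγ0 hu 0 n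
    rw [zero_add] at h
    rw [h]
    simp only [hu_def, AddChar.map_zero_eq_one]
    ring
  have hsite : ∀ n : ℤ, ((sitePotential p q φ n : ℝ) : ℂ) = u (n : ZMod q) + (u (n : ZMod q))⁻¹ := by
    intro n
    rw [hun, sitePotential, two_mul_cos_site]
  set h := harperMatrix u with hh
  have hherm : h.IsHermitian := isHermitian_harperMatrix hu1
  -- Rows and columns of the Harper matrix.
  have hmulVec : ∀ (f : ZMod q → ℂ) (a : ZMod q), h.mulVec f a =
      f (a - 1) + f (a + 1) + (u a + (u a)⁻¹) * f a := by
    intro f a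
    have hw : ∀ i j : ℤ, (weylMatrix u i j).mulVec f a =
        u (a - (i : ZMod q)) ^ j * f (a - (i : ZMod q)) := by
      intro i j
      rw [Matrix.mulVec, dotProduct, Finset.sum_eq_single (a - (i : ZMod q))]
      · rw [weylMatrix_apply, if_pos (by ring)]
      · intro b _ hb
        rw [weylMatrix_apply, if_neg, zero_mul]
        rintro rfl
        simp at hb
      · simp
    rw [hh, harperMatrix, Matrix.add_mulVec, Matrix.add_mulVec, Matrix.add_mulVec]
    simp only [Pi.add_apply, hw]
    push_cast
    simp
    ring
  set c : ℝ := 2 + 2 * Real.cos (q * φ) with hc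
  set P := -discriminant p q with hP
  have hmonic : (P - C c).Monic := by
    refine (monic_neg_discriminant hq0).sub_of_left (degree_C_le.trans_lt ?_)
    rw [degree_eq_natDegree (monic_neg_discriminant hq0).ne_zero, natDegree_neg_discriminant hq0]
    exact_mod_cast Nat.pos_of_ne_zero hq0
  have hdeg : (P - C c).natDegree = q := by
    rw [natDegree_sub_C, natDegree_neg_discriminant hq0]
  have hann : aeval h ((P - C c).map (algebraMap ℝ ℂ)) = 0 := by
    set e : ℤ → ZMod q → ℂ := fun n a => if a = (n : ZMod q) then 1 else 0 with he
    have key := aeval_neg_discriminant_smul hodd hpq φ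
      (Matrix.toLinAlgEquiv' h : Module.End ℂ (ZMod q → ℂ)) e (fun n => by
        rw [Module.End.smul_def, Matrix.toLinAlgEquiv'_apply, Module.algebraMap_end_eq_smul_id]
        funext a
        rw [hmulVec]
        simp only [Pi.add_apply, Module.End.smul_def, LinearMap.smul_apply, LinearMap.id_apply,
          Pi.smul_apply, smul_eq_mul, hsite, he]
        push_cast
        have e1 : (a - 1 = (n : ZMod q)) ↔ (a = (n : ZMod q) + 1) := sub_eq_iff_eq_add
        have e2 : (a + 1 = (n : ZMod q)) ↔ (a = (n : ZMod q) - 1) := eq_sub_iff_add_eq.symm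
        simp only [e1, e2]
        by_cases ha : a = (n : ZMod q)
        · subst ha
          ring
        · simp [ha])
    rw [← Matrix.toLinAlgEquiv'.injective.eq_iff, map_zero]
    have hPc : (P - C c).map (algebraMap ℝ ℂ) =
        (P - C (2 * Real.cos (q * φ))).map (algebraMap ℝ ℂ) - C 2 := by
      rw [hc, C_add, Polynomial.map_sub, Polynomial.map_sub, Polynomial.map_add, map_C, map_C]
      simp only [map_ofNat]
      ring
    rw [← aeval_algHom_apply, hPc, map_sub, aeval_C]
    refine LinearMap.pi_ext' fun b => LinearMap.ext_ring ?_
    have hb := key (b.val : ℤ)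
    rw [Module.End.smul_def] at hb
    have hbe : ∀ k : ℤ, (k : ZMod q) = b → e k = Pi.single b (1 : ℂ) := by
      intro k hk
      funext a
      rw [he, Pi.single_apply]
      simp only [hk]
    have hbv : (((b.val : ℤ)) : ZMod q) = b := by simp
    rw [hbe _ hbv, hbe _ (by simp), hbe _ (by simp)] at hb
    simp only [LinearMap.coe_comp, Function.comp_apply, LinearMap.single_apply, LinearMap.sub_apply,
      LinearMap.zero_apply]
    rw [hb, Module.algebraMap_end_apply, two_smul, sub_self]
  have hev := (aeval_eq_zero_iff_eigenvalues hherm _).1 hann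
  have hroot : ∀ i, (P - C c).eval (hherm.eigenvalues i) = 0 := by
    intro i
    have := hev i
    rw [← Complex.coe_algebraMap, eval_map_algebraMap, aeval_algebraMap_apply] at this
    rw [coe_aeval_eq_eval] at this
    exact Complex.ofReal_eq_zero.1 this
  set s := Finset.univ.image hherm.eigenvalues with hs
  have hmem : ∀ i, hherm.eigenvalues i ∈ s := fun i => Finset.mem_image_of_mem _ (Finset.mem_univ i)
  have hcard_le : s.card ≤ q := Finset.card_image_le.trans (by simp [ZMod.card])
  have hcard : s.card = q := by
    by_contra hne
    have hlt : s.card ≤ 2 * m := by omega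
    set g : ℂ[X] := (∏ x ∈ s, (X - C (x : ℂ))) * X ^ (2 * m - s.card) with hg
    have hgm : g.Monic := (monic_prod_of_monic _ _ fun x _ => monic_X_sub_C _).mul (monic_X_pow _)
    have hgd : g.natDegree = 2 * m := by
      rw [hg, (monic_prod_of_monic _ _ fun x _ => monic_X_sub_C _).natDegree_mul (monic_X_pow _),
        natDegree_prod_of_monic _ _ fun x _ => monic_X_sub_C _]
      simp
      omega
    have h1 := norm_weylCoeff_aeval hm hγ hu hu0 hgm hgd
    rw [(aeval_eq_zero_iff_eigenvalues hherm g).2, map_zero, norm_zero] at h1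
    · exact hq0 (by exact_mod_cast h1.symm)
    · intro i
      rw [hg, eval_mul, eval_prod, Finset.prod_eq_zero (hmem i) (by simp), zero_mul]
  have hinj : Function.Injective hherm.eigenvalues := by
    have h1 : (Finset.univ.image hherm.eigenvalues).card = (Finset.univ : Finset (ZMod q)).card := by
      rw [← hs, hcard, Finset.card_univ, ZMod.card]
    have h2 := Finset.card_image_iff.1 h1
    rwa [Finset.coe_univ, Set.injOn_univ] at h2
  have hle : s.val ≤ (P - C c).roots := by
    rw [Multiset.le_iff_subset s.nodup]
    intro x hx
    obtain ⟨i, -, rfl⟩ := Finset.mem_image.1 (Finset.mem_def.2 hx)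
    exact (mem_roots hmonic.ne_zero).2 (hroot i)
  have hroots : s.val = (P - C c).roots := by
    refine Multiset.eq_of_le_of_card_le hle ((card_roots' _).trans ?_)
    rw [hdeg]
    exact hcard.ge
  have hprod : P - C c = ∏ x ∈ s, (X - C x) := by
    rw [← prod_multiset_X_sub_C_of_monic_of_roots_card_eq hmonic, ← hroots]
    · rfl
    · rw [← hroots, hdeg]
      exact hcard
  refine ⟨s, hcard, hprod, fun x hx => ⟨?_, ?_⟩⟩
  · have hd : (derivative P).eval x = ∏ y ∈ s.erase x, (x - y) := by
      rw [← eval_derivative_prod_X_sub_C hx, ← hprod]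
      simp
    obtain ⟨i₀, -, rfl⟩ := Finset.mem_image.1 hx
    set g : ℂ[X] := ∏ y ∈ s.erase (hherm.eigenvalues i₀), (X - C (y : ℂ)) with hg
    have hgm : g.Monic := monic_prod_of_monic _ _ fun x _ => monic_X_sub_C _
    have hgd : g.natDegree = 2 * m := by
      rw [hg, natDegree_prod_of_monic _ _ fun x _ => monic_X_sub_C _]
      simp [Finset.card_erase_of_mem hx, hcard, hm]
    have h1 := norm_weylCoeff_aeval hm hγ hu hu0 hgm hgd
    have hge : g.eval ((hherm.eigenvalues i₀ : ℝ) : ℂ) =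
        (((derivative P).eval (hherm.eigenvalues i₀) : ℝ) : ℂ) := by
      rw [hd, hg, eval_prod]
      simp
    have h2 : ‖weylCoeff u m (aeval h g)‖ ≤ q * |(derivative P).eval (hherm.eigenvalues i₀)| := by
      rw [weylCoeff_apply]
      refine (norm_sum_le _ _).trans ?_
      have h3 : ∀ b ∈ (Finset.univ : Finset (ZMod q)),
          ‖(u b ^ m)⁻¹ * aeval h g (b + (m : ZMod q)) b‖ ≤
            |(derivative P).eval (hherm.eigenvalues i₀)| := by
        intro b _
        rw [norm_mul, norm_inv, norm_pow, hu1, one_pow, inv_one, one_mul]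
        refine (norm_aeval_apply_le hherm g i₀ ?_ _ _).trans ?_
        · intro i hi
          rw [hg, eval_prod]
          refine Finset.prod_eq_zero (Finset.mem_erase.2 ⟨fun h => hi (hinj h), hmem i⟩) (by simp)
        · rw [hge, Complex.norm_real, Real.norm_eq_abs]
      refine (Finset.sum_le_card_nsmul _ _ _ h3).trans ?_
      rw [Finset.card_univ, ZMod.card, nsmul_eq_mul]
    rw [h1] at h2
    have hqpos : (0 : ℝ) < q := Nat.cast_pos.2 (Nat.pos_of_ne_zero hq0)
    exact le_of_mul_le_mul_left (by rwa [mul_one]) hqpos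
  · obtain ⟨i₀, -, rfl⟩ := Finset.mem_image.1 hx
    set w : ZMod q → ℂ := (hherm.eigenvectorBasis i₀).ofLp with hw
    have hmv := hherm.mulVec_eigenvectorBasis i₀
    refine ⟨fun n => w (n : ZMod q), ?_, ?_, ?_⟩
    · intro h0
      have hne := hherm.eigenvectorBasis.orthonormal.ne_zero i₀
      apply hne
      ext b
      have := congrFun h0 (b.val : ℤ)
      simpa using this
    · intro n
      simp
    · intro n
      have := congrFun hmv (n : ZMod q)
      rw [← hw, hmulVec] at this
      rw [hsite]
      push_cast
      rw [Pi.smul_apply, Complex.real_smul] at this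
      rw [← this]
      ring

/-! ### The spectrum on the square-summable sequences -/

/-- The standard basis vector of `ℓ²(ℤ)` at the site `n`. -/
noncomputable def siteVector (n : ℤ) : EllTwo := lp.single 2 n (1 : ℂ)

theorem siteVector_apply (n k : ℤ) : siteVector n k = if k = n then 1 else 0 := by
  rw [siteVector, lp.single_apply, Pi.single_apply]

theorem norm_siteVector (n : ℤ) : ‖siteVector n‖ = 1 := by
  rw [siteVector, lp.norm_single (by norm_num), norm_one]

theorem single_eq_smul_siteVector (n : ℤ) (c : ℂ) :
    (lp.single 2 n c : EllTwo) = c • siteVector n := by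
  ext k
  rw [lp.coeFn_smul, Pi.smul_apply, siteVector_apply, lp.single_apply, Pi.single_apply]
  simp

/-- Bounded operators on `ℓ²(ℤ)` that agree on the standard basis are equal. -/
theorem clm_ext_siteVector {S T : EllTwo →L[ℂ] EllTwo}
    (h : ∀ n, S (siteVector n) = T (siteVector n)) : S = T := by
  ext1 φ
  have hφ := lp.hasSum_single (p := 2) (by norm_num) φ
  have h1 : ∀ n, S (lp.single 2 n (φ n)) = T (lp.single 2 n (φ n)) := by
    intro n
    rw [single_eq_smul_siteVector, map_smul, map_smul, h]
  have h2 := S.hasSum hφ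
  have h3 := T.hasSum hφ
  simp only [h1] at h2 h3
  exact h2.unique h3

theorem translation_apply (k : ℤ) (φ : EllTwo) (n : ℤ) : translation k φ n = φ (n + k) := rfl

theorem potentialOp_apply (α θ : ℝ) (φ : EllTwo) (n : ℤ) :
    potentialOp α θ φ n = (potential α θ n : ℂ) * φ n := rfl

theorem translation_siteVector (k n : ℤ) : translation k (siteVector n) = siteVector (n - k) := by
  ext j
  rw [translation_apply, siteVector_apply, siteVector_apply]
  simp only [eq_sub_iff_add_eq]

theorem potentialOp_siteVector (α θ : ℝ) (n : ℤ) :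
    potentialOp α θ (siteVector n) = (potential α θ n : ℂ) • siteVector n := by
  ext j
  rw [potentialOp_apply, lp.coeFn_smul, Pi.smul_apply, siteVector_apply, smul_eq_mul]
  split_ifs with h
  · rw [h]
  · simp

theorem almostMathieu_siteVector (α θ : ℝ) (n : ℤ) :
    almostMathieu α θ (siteVector n) =
      siteVector (n + 1) + siteVector (n - 1) + (potential α θ n : ℂ) • siteVector n := by
  rw [almostMathieu, add_apply, add_apply,
    translation_siteVector, translation_siteVector, potentialOp_siteVector, sub_neg_eq_add]

theorem norm_translation_le (k : ℤ) : ‖translation k‖ ≤ 1 :=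
  LinearMap.mkContinuous_norm_le _ zero_le_one _

theorem norm_almostMathieu_le (α θ : ℝ) : ‖almostMathieu α θ‖ ≤ 4 := by
  have h : ‖potentialOp α θ‖ ≤ 2 := LinearMap.mkContinuous_norm_le _ zero_le_two _
  have h1 := norm_translation_le (-1)
  have h2 := norm_translation_le 1
  have h3 := norm_add_le (translation (-1) + translation 1) (potentialOp α θ)
  have h4 := norm_add_le (translation (-1)) (translation 1)
  rw [almostMathieu]
  linarith

instance : Nontrivial EllTwo :=
  ⟨siteVector 0, 0, fun h => by simpa [h] using norm_siteVector 0⟩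

theorem abs_le_four_of_mem_specUnion {α E : ℝ} (h : E ∈ specUnion α) : |E| ≤ 4 := by
  obtain ⟨θ, -, hE⟩ := h
  have h1 := spectrum.norm_le_norm_of_mem hE
  rw [Complex.norm_real, Real.norm_eq_abs] at h1
  exact h1.trans (norm_almostMathieu_le α θ)

theorem potential_eq_sitePotential (p q : ℕ) (θ : ℝ) (n : ℤ) :
    potential ((p : ℝ) / q) θ n = sitePotential p q (2 * Real.pi * θ) n := by
  rw [potential, sitePotential]
  congr 2
  ring

/-- The magic formula on `ℓ²(ℤ)` and spectral mapping: on the spectrum the discriminant is bounded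
by four. -/
theorem abs_eval_le_of_mem_specUnion {p q : ℕ} (hodd : Odd q) (hpq : Nat.Coprime p q) {E : ℝ}
    (h : E ∈ specUnion ((p : ℝ) / q)) : |(-discriminant p q).eval E| ≤ 4 := by
  obtain ⟨θ, -, hE⟩ := h
  set H := almostMathieu ((p : ℝ) / q) θ with hH
  set c : ℝ := 2 * Real.cos (q * (2 * Real.pi * θ)) with hc
  set D := (-discriminant p q - C c).map (algebraMap ℝ ℂ) with hD
  have hmagic : aeval H D = translation (-q) + translation q := by
    refine clm_ext_siteVector fun n => ?_
    have key := aeval_neg_discriminant_smul hodd hpq (2 * Real.pi * θ) H siteVector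
      (fun n => by
        rw [← potential_eq_sitePotential, Algebra.algebraMap_eq_smul_one]
        exact almostMathieu_siteVector _ _ n) n
    rw [add_apply, translation_siteVector, translation_siteVector,
      sub_neg_eq_add]
    exact key
  have h1 : D.eval (E : ℂ) ∈ spectrum ℂ (aeval H D) :=
    spectrum.subset_polynomial_aeval H D ⟨E, hE, rfl⟩
  have h2 := spectrum.norm_le_norm_of_mem h1
  have h3 : D.eval (E : ℂ) = (((-discriminant p q).eval E - c : ℝ) : ℂ) := by
    rw [hD, ← Complex.coe_algebraMap, eval_map_algebraMap, aeval_algebraMap_apply,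
      coe_aeval_eq_eval, eval_sub, eval_C]
  rw [h3, Complex.norm_real, Real.norm_eq_abs, hmagic] at h2
  have h4 := norm_add_le (translation (-(q : ℤ))) (translation q)
  have h5 := norm_translation_le (-(q : ℤ))
  have h6 := norm_translation_le q
  have h7 : |c| ≤ 2 := by
    rw [hc, abs_mul, abs_two]
    linarith [Real.abs_cos_le_one (q * (2 * Real.pi * θ))]
  have h8 := abs_sub_abs_le_abs_sub ((-discriminant p q).eval E) c
  linarith

/-- Truncations of a periodic solution form a Weyl sequence: the truncated sequence is an
eigenvector up to boundary terms, while its norm is unbounded. -/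
theorem mem_spectrum_of_periodic (α θ E : ℝ) {f : ℤ → ℂ} (hf0 : f ≠ 0) {N : ℕ} (hN : 0 < N)
    (hper : ∀ n, f (n + N) = f n)
    (hf : ∀ n, f (n + 1) + f (n - 1) + (potential α θ n : ℂ) * f n = E * f n) :
    (E : ℂ) ∈ spectrum ℂ (almostMathieu α θ) := by
  by_contra hE
  obtain ⟨U, hU⟩ := spectrum.notMem_iff.1 hE
  set H := almostMathieu α θ with hH
  set B : EllTwo →L[ℂ] EllTwo := ((U⁻¹ : (EllTwo →L[ℂ] EllTwo)ˣ) : EllTwo →L[ℂ] EllTwo) with hB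
  have hBU : ∀ φ, B ((algebraMap ℂ (EllTwo →L[ℂ] EllTwo) E - H) φ) = φ := by
    intro φ
    rw [← hU, ← mul_apply_eq_comp, hB, Units.inv_mul, one_apply_eq_self]
  have hmod : ∀ n : ℤ, f (n % N) = f n := by
    intro n
    have hp : Function.Periodic f (N : ℤ) := hper
    have h := hp.int_mul (n / N) (n % N)
    rw [← h]
    congr 1
    rw [mul_comm]
    exact Int.emod_add_mul_ediv n N
  have hmod' : ∀ n : ℤ, ∃ k ∈ Finset.range N, f n = f (k : ℕ) := by
    intro n
    have h0 := Int.emod_nonneg n (by omega : (N : ℤ) ≠ 0)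
    have h1 := Int.emod_lt_of_pos n (by omega : (0 : ℤ) < N)
    refine ⟨(n % N).toNat, Finset.mem_range.2 (by omega), ?_⟩
    rw [Int.toNat_of_nonneg h0, hmod]
  set K₀ : ℝ := ∑ k ∈ Finset.range N, ‖f (k : ℕ)‖ with hK₀
  have hbound : ∀ n, ‖f n‖ ≤ K₀ := by
    intro n
    obtain ⟨k, hk, hk'⟩ := hmod' n
    rw [hk']
    exact Finset.single_le_sum (f := fun k : ℕ => ‖f (k : ℕ)‖) (fun _ _ => norm_nonneg _) hk
  set T : ℝ := ∑ k ∈ Finset.range N, ‖f (k : ℕ)‖ ^ 2 with hT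
  have hTpos : 0 < T := by
    obtain ⟨n, hn⟩ := Function.ne_iff.1 hf0
    obtain ⟨k, hk, hk'⟩ := hmod' n
    refine Finset.sum_pos' (fun _ _ => by positivity) ⟨k, hk, ?_⟩
    rw [← hk']
    have : f n ≠ 0 := hn
    positivity
  have hsum : ∀ K : ℕ, ∑ n ∈ Finset.range (N * K), ‖f (n : ℕ)‖ ^ 2 = K * T := by
    intro K
    induction K with
    | zero => simp
    | succ K ih =>
      have hshift : ∀ k : ℕ, f ((N * K + k : ℕ) : ℤ) = f (k : ℕ) := by
        intro k
        rw [← hmod, ← hmod (k : ℕ)]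
        congr 1
        push_cast
        rw [add_comm, Int.add_mul_emod_self_left]
      rw [Nat.mul_succ, Finset.sum_range_add, ih]
      simp only [hshift]
      push_cast
      ring
  set φ : ℕ → EllTwo := fun L => ∑ n ∈ Finset.range L, f (n : ℕ) • siteVector (n : ℕ) with hφ
  have hnorm : ∀ L, ‖φ L‖ ^ 2 = ∑ n ∈ Finset.range L, ‖f (n : ℕ)‖ ^ 2 := by
    intro L
    have h := lp.norm_sum_single (p := 2) (E := fun _ : ℤ => ℂ) (by norm_num) f
      ((Finset.range L).map Nat.castEmbedding)
    simp only [Finset.sum_map, Nat.castEmbedding_apply, single_eq_smul_siteVector] at h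
    simpa using h
  set y : ℕ → EllTwo := fun n => f ((n : ℤ) - 1) • siteVector n - f n • siteVector ((n : ℤ) - 1)
    with hy
  have hy_norm : ∀ n, ‖y n‖ ≤ 2 * K₀ := by
    intro n
    refine (norm_sub_le _ _).trans ?_
    rw [norm_smul, norm_smul, norm_siteVector, norm_siteVector, mul_one, mul_one]
    linarith [hbound ((n : ℤ) - 1), hbound n]
  have htel : ∀ L, (algebraMap ℂ (EllTwo →L[ℂ] EllTwo) E - H) (φ L) = -(y L - y 0) := by
    intro L
    rw [← Finset.sum_range_sub, hφ, map_sum, ← Finset.sum_neg_distrib]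
    refine Finset.sum_congr rfl fun n _ => ?_
    rw [map_smul, sub_apply, Algebra.algebraMap_eq_smul_one,
      smul_apply, one_apply_eq_self, hH, almostMathieu_siteVector]
    simp only [hy]
    have h1 := hf (n : ℕ)
    have h2 : f (n : ℕ) • (E : ℂ) • siteVector (n : ℕ) =
        (f ((n : ℤ) + 1) + f ((n : ℤ) - 1) + (potential α θ n : ℂ) * f n) • siteVector (n : ℕ) := by
      rw [h1, smul_smul, mul_comm]
    rw [smul_sub, h2]
    push_cast
    rw [add_sub_cancel_right]
    module
  have hle : ∀ K : ℕ, K * T ≤ (‖B‖ * (4 * K₀)) ^ 2 := by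
    intro K
    rw [← hsum, ← hnorm]
    refine pow_le_pow_left₀ (norm_nonneg _) ?_ 2
    calc ‖φ (N * K)‖ = ‖B ((algebraMap ℂ (EllTwo →L[ℂ] EllTwo) E - H) (φ (N * K)))‖ := by
          rw [hBU]
      _ ≤ ‖B‖ * ‖(algebraMap ℂ (EllTwo →L[ℂ] EllTwo) E - H) (φ (N * K))‖ := B.le_opNorm _
      _ ≤ ‖B‖ * (4 * K₀) := by
          refine mul_le_mul_of_nonneg_left ?_ (norm_nonneg _)
          rw [htel, norm_neg]
          linarith [norm_sub_le (y (N * K)) (y 0), hy_norm (N * K), hy_norm 0]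
  obtain ⟨K, hK⟩ := exists_nat_gt ((‖B‖ * (4 * K₀)) ^ 2 / T)
  rw [div_lt_iff₀ hTpos] at hK
  exact absurd (hle K) (not_le.2 hK)

/-- `S(p/q)` is the set where the discriminant is bounded by four. -/
theorem specUnion_eq {p q : ℕ} (hq : 3 ≤ q) (hodd : Odd q) (hpq : Nat.Coprime p q) :
    specUnion ((p : ℝ) / q) = {E | |(-discriminant p q).eval E| ≤ 4} := by
  refine Set.Subset.antisymm (fun E hE => abs_eval_le_of_mem_specUnion hodd hpq hE) ?_
  intro E hE
  rw [Set.mem_ofPred_eq, abs_le] at hE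
  have hqpos : (0 : ℝ) < q := by positivity
  have hq3 : (3 : ℝ) ≤ q := by exact_mod_cast hq
  have hpi := Real.pi_pos
  -- For a nonnegative level there is a `q`-periodic eigenvector, with a phase in `(0, 1/q]`.
  have main : ∀ x : ℝ, 0 ≤ (-discriminant p q).eval x → (-discriminant p q).eval x ≤ 4 →
      ∃ θ : ℝ, 0 < θ ∧ θ ≤ 1 / q ∧ ∃ f : ℤ → ℂ, f ≠ 0 ∧ (∀ n, f (n + q) = f n) ∧
        ∀ n, f (n + 1) + f (n - 1) + (potential ((p : ℝ) / q) θ n : ℂ) * f n = x * f n := by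
    intro x h0 h4
    set P := (-discriminant p q).eval x with hP
    set a := Real.arccos (P / 2 - 1) with ha
    have ha0 : 0 ≤ a := Real.arccos_nonneg _
    have ha1 : a ≤ Real.pi := Real.arccos_le_pi _
    have hcos : Real.cos a = P / 2 - 1 := Real.cos_arccos (by linarith) (by linarith)
    set φ := (2 * Real.pi - a) / q with hφ
    have hqφ : Real.cos (q * φ) = P / 2 - 1 := by
      rw [hφ, mul_div_cancel₀ _ hqpos.ne', Real.cos_two_pi_sub, hcos]
    obtain ⟨s, -, hs, hs'⟩ := exists_level_roots hodd hpq φ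
    have hx : x ∈ s := by
      have h := congrArg (eval x) hs
      rw [eval_sub, eval_C, hqφ, ← hP, eval_prod] at h
      have h1 : ∏ y ∈ s, eval x (X - C y) = 0 := by
        rw [← h]
        ring
      obtain ⟨y, hy, hxy⟩ := Finset.prod_eq_zero_iff.1 h1
      rw [eval_sub, eval_X, eval_C, sub_eq_zero] at hxy
      rwa [hxy]
    obtain ⟨-, f, hf0, hf1, hf2⟩ := hs' x hx
    refine ⟨φ / (2 * Real.pi), ?_, ?_, f, hf0, hf1, fun n => ?_⟩
    · have : 0 < 2 * Real.pi - a := by linarith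
      positivity
    · rw [hφ, div_div, div_le_div_iff₀ (by positivity) hqpos, one_mul]
      nlinarith
    · rw [potential_eq_sitePotential, mul_div_cancel₀ _ (by positivity)]
      exact hf2 n
  have hq1 : 1 / (q : ℝ) ≤ 1 / 3 := one_div_le_one_div_of_le (by norm_num) hq3
  rcases le_total 0 ((-discriminant p q).eval E) with h | h
  · obtain ⟨θ, h0, h1, f, hf0, hf1, hf2⟩ := main E h hE.2
    exact ⟨θ, ⟨h0, by linarith⟩, mem_spectrum_of_periodic _ _ _ hf0 (by omega) hf1 hf2⟩
  · -- Multiplication by `(-1)ⁿ` and the phase `θ + 1/2` exchange `E` and `-E`.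
    have hneg := eval_neg_neg_discriminant hodd hpq E
    obtain ⟨θ, h0, h1, f, hf0, hf1, hf2⟩ := main (-E) (by linarith) (by linarith)
    refine ⟨θ + 1 / 2, ⟨by linarith, by linarith⟩, ?_⟩
    refine mem_spectrum_of_periodic _ _ _ (f := fun n => (-1 : ℂ) ^ n * f n) (N := 2 * q) ?_
      (by omega) (fun n => ?_) (fun n => ?_)
    · intro hz
      apply hf0
      funext n
      exact (mul_eq_zero.1 (congrFun hz n)).resolve_left (zpow_ne_zero n (by norm_num))
    · have e1 : f (n + (2 * q : ℕ)) = f n := by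
        rw [← hf1 n, ← hf1 (n + q)]
        congr 1
        push_cast
        ring
      have e2 : (-1 : ℂ) ^ (n + ((2 * q : ℕ) : ℤ)) = (-1) ^ n := by
        rw [zpow_add₀ (by norm_num), zpow_natCast, pow_mul]
        simp
      simp only [e1, e2]
    · have e0 : potential ((p : ℝ) / q) (θ + 1 / 2) n = -potential ((p : ℝ) / q) θ n := by
        rw [potential, potential, show 2 * Real.pi * ((p : ℝ) / q * n + (θ + 1 / 2)) =
          2 * Real.pi * ((p : ℝ) / q * n + θ) + Real.pi by ring, Real.cos_add_pi]
        ring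
      have e1 : (-1 : ℂ) ^ (n + 1) = -(-1) ^ n := by
        rw [zpow_add_one₀ (by norm_num)]
        ring
      have e2 : (-1 : ℂ) ^ (n - 1) = -(-1) ^ n := by
        rw [zpow_sub_one₀ (by norm_num)]
        norm_num
      have h2 := hf2 n
      simp only [e0, e1, e2]
      push_cast at h2 ⊢
      linear_combination (-(-1 : ℂ) ^ n) * h2

/-! ### The band structure -/

/-- The zeros of `P - c`, numbered from left to right by `-m, …, m`. -/
noncomputable def levelRoot (P : ℝ[X]) (m : ℕ) (c : ℝ) (k : ℤ) : ℝ :=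
  ((P - C c).roots.sort (· ≤ ·)).getD (k + m).toNat 0

/-- An odd polynomial of degree `2m + 1` that attains every level in `[-4, 4]` at `2m + 1` distinct
real points, with derivative at least one there. -/
structure IsBandPolynomial (P : ℝ[X]) (m : ℕ) : Prop where
  natDegree_eq : P.natDegree = 2 * m + 1
  eval_neg : ∀ x, P.eval (-x) = -P.eval x
  exists_roots : ∀ c : ℝ, |c| ≤ 4 →
    ∃ s : Finset ℝ, s.card = 2 * m + 1 ∧ P - C c = ∏ x ∈ s, (X - C x)
  one_le_abs_derivative : ∀ x, |P.eval x| ≤ 4 → 1 ≤ |(derivative P).eval x|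

theorem levelRoot_eq_orderEmbOfFin {P : ℝ[X]} {m : ℕ} {c : ℝ} {s : Finset ℝ}
    (hs : s.card = 2 * m + 1) (hP : P - C c = ∏ x ∈ s, (X - C x)) {k : ℤ}
    (hk : (k + m).toNat < 2 * m + 1) :
    levelRoot P m c k = s.orderEmbOfFin hs ⟨(k + m).toNat, hk⟩ := by
  rw [levelRoot, hP, roots_prod_X_sub_C, Finset.orderEmbOfFin_apply]
  exact List.getD_eq_getElem _ _ (by simpa [hs] using hk)

theorem toNat_add_lt {m : ℕ} {k : ℤ} (hk : k ∈ Set.Icc (-(m : ℤ)) m) :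
    (k + m).toNat < 2 * m + 1 := by
  have := hk.1
  have := hk.2
  omega

/-- A strictly increasing enumeration of the zeros of `P - c` is `levelRoot`. -/
theorem eq_levelRoot {P : ℝ[X]} {m : ℕ} {c : ℝ} {s : Finset ℝ}
    (hs : s.card = 2 * m + 1) (hP : P - C c = ∏ x ∈ s, (X - C x)) {f : ℤ → ℝ}
    (hf : StrictMonoOn f (Set.Icc (-(m : ℤ)) m)) (hfs : ∀ k ∈ Set.Icc (-(m : ℤ)) m, f k ∈ s)
    {k : ℤ} (hk : k ∈ Set.Icc (-(m : ℤ)) m) : f k = levelRoot P m c k := by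
  have hi : ∀ i : Fin (2 * m + 1), ((i : ℕ) : ℤ) - m ∈ Set.Icc (-(m : ℤ)) m := by
    intro i
    have := i.2
    constructor <;> omega
  have h1 := Finset.orderEmbOfFin_unique hs (f := fun i : Fin (2 * m + 1) => f ((i : ℕ) - m))
    (fun i => hfs _ (hi i)) (fun i j hij => hf (hi i) (hi j) (by
      have : (i : ℕ) < j := hij
      omega))
  rw [levelRoot_eq_orderEmbOfFin hs hP (toNat_add_lt hk), ← h1]
  have h0 := hk.1
  simp only
  rw [Int.toNat_of_nonneg (by omega), add_sub_cancel_right]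

namespace IsBandPolynomial

variable {P : ℝ[X]} {m : ℕ}

theorem strictMonoOn_levelRoot (h : IsBandPolynomial P m) {c : ℝ} (hc : |c| ≤ 4) :
    StrictMonoOn (levelRoot P m c) (Set.Icc (-(m : ℤ)) m) := by
  obtain ⟨s, hs, hP⟩ := h.exists_roots c hc
  intro k hk l hl hkl
  rw [levelRoot_eq_orderEmbOfFin hs hP (toNat_add_lt hk),
    levelRoot_eq_orderEmbOfFin hs hP (toNat_add_lt hl)]
  refine (s.orderEmbOfFin hs).strictMono ?_
  have := hk.1
  rw [Fin.mk_lt_mk]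
  omega

theorem sub_C_eq_prod (h : IsBandPolynomial P m) {c : ℝ} (hc : |c| ≤ 4) :
    P - C c = ∏ k ∈ Finset.Icc (-(m : ℤ)) m, (X - C (levelRoot P m c k)) := by
  obtain ⟨s, hs, hP⟩ := h.exists_roots c hc
  have hmono := h.strictMonoOn_levelRoot hc
  conv_lhs => rw [hP]
  symm
  refine Finset.prod_nbij (levelRoot P m c) (fun k hk => ?_) ?_ ?_ fun _ _ => rfl
  · rw [← Finset.mem_coe, Finset.coe_Icc] at hk
    rw [levelRoot_eq_orderEmbOfFin hs hP (toNat_add_lt hk)]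
    exact Finset.orderEmbOfFin_mem s hs _
  · rw [Finset.coe_Icc]
    exact hmono.injOn
  · intro x hx
    rw [← Finset.range_orderEmbOfFin s hs] at hx
    obtain ⟨i, rfl⟩ := hx
    have := i.2
    refine ⟨(i : ℕ) - m, ?_, ?_⟩
    · rw [Finset.coe_Icc]
      constructor <;> omega
    · rw [levelRoot_eq_orderEmbOfFin hs hP (by omega)]
      congr 1
      ext
      simp

theorem eval_sub_eq_prod (h : IsBandPolynomial P m) {c : ℝ} (hc : |c| ≤ 4) (x : ℝ) :
    P.eval x - c = ∏ k ∈ Finset.Icc (-(m : ℤ)) m, (x - levelRoot P m c k) := by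
  have h1 := congrArg (eval x) (h.sub_C_eq_prod hc)
  rw [eval_sub, eval_C, eval_prod] at h1
  simpa using h1

theorem eval_levelRoot (h : IsBandPolynomial P m) {c : ℝ} (hc : |c| ≤ 4) {k : ℤ}
    (hk : k ∈ Set.Icc (-(m : ℤ)) m) : P.eval (levelRoot P m c k) = c := by
  have h1 := h.eval_sub_eq_prod hc (levelRoot P m c k)
  have h2 := Finset.prod_eq_zero (f := fun j => levelRoot P m c k - levelRoot P m c j)
    (Finset.mem_Icc.2 hk) (sub_self _)
  linarith

theorem exists_eq_levelRoot (h : IsBandPolynomial P m) {x : ℝ} (hx : |P.eval x| ≤ 4) :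
    ∃ k ∈ Set.Icc (-(m : ℤ)) m, x = levelRoot P m (P.eval x) k := by
  have h1 := h.eval_sub_eq_prod hx x
  rw [sub_self] at h1
  obtain ⟨k, hk, hk'⟩ := Finset.prod_eq_zero_iff.1 h1.symm
  exact ⟨k, Finset.mem_Icc.1 hk, sub_eq_zero.1 hk'⟩

theorem derivative_ne_zero (h : IsBandPolynomial P m) : derivative P ≠ 0 := by
  intro h0
  have := derivative_eq_zero.1 h0
  have := h.natDegree_eq
  omega

/-- Zeros of different levels are separated: otherwise the critical points that Rolle's theorem
places between the zeros of the two levels would exceed the degree of the derivative. -/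
theorem levelRoot_lt_levelRoot (h : IsBandPolynomial P m) {c c' : ℝ} (hc : |c| ≤ 4)
    (hc' : |c'| ≤ 4) {k l : ℤ} (hk : -(m : ℤ) ≤ k) (hl : l ≤ m) (hkl : k < l) :
    levelRoot P m c k < levelRoot P m c' l := by
  have rolle : ∀ c : ℝ, |c| ≤ 4 → ∀ i : ℤ, ∃ ξ : ℝ, -(m : ℤ) ≤ i → i < m →
      levelRoot P m c i < ξ ∧ ξ < levelRoot P m c (i + 1) ∧ (derivative P).eval ξ = 0 := by
    intro c hc i
    by_cases hi : -(m : ℤ) ≤ i ∧ i < m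
    · have h1 : i ∈ Set.Icc (-(m : ℤ)) m := ⟨by omega, by omega⟩
      have h2 : i + 1 ∈ Set.Icc (-(m : ℤ)) m := ⟨by omega, by omega⟩
      obtain ⟨ξ, hξ, hξ'⟩ := exists_deriv_eq_zero (f := fun x => P.eval x)
        (h.strictMonoOn_levelRoot hc h1 h2 (by omega)) P.continuous.continuousOn
        (by simp only [h.eval_levelRoot hc h1, h.eval_levelRoot hc h2])
      rw [Polynomial.deriv] at hξ'
      exact ⟨ξ, fun _ _ => ⟨hξ.1, hξ.2, hξ'⟩⟩
    · exact ⟨0, fun h3 h4 => absurd ⟨h3, h4⟩ hi⟩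
  choose ξ hξ using rolle c hc
  choose η hη using rolle c' hc'
  by_contra! hle
  have hle' : levelRoot P m c' (k + 1) ≤ levelRoot P m c k :=
    ((h.strictMonoOn_levelRoot hc').monotoneOn ⟨by omega, by omega⟩ ⟨by omega, hl⟩
      (by omega)).trans hle
  have hmc := (h.strictMonoOn_levelRoot hc).monotoneOn
  have hmc' := (h.strictMonoOn_levelRoot hc').monotoneOn
  -- The critical points below `levelRoot c' (k + 1)` followed by those above `levelRoot c k`.
  set ζ : ℤ → ℝ := fun i => if i ≤ k then η i else ξ (i - 1) with hζ
  have hζ0 : ∀ i ∈ Finset.Icc (-(m : ℤ)) m, ζ i ∈ (derivative P).roots.toFinset := by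
    intro i hi
    rw [Finset.mem_Icc] at hi
    rw [Multiset.mem_toFinset, mem_roots h.derivative_ne_zero, IsRoot.def, hζ]
    dsimp only
    split_ifs with hik
    · exact (hη i hi.1 (by omega)).2.2
    · exact (hξ (i - 1) (by omega) (by omega)).2.2
  have hζmono : StrictMonoOn ζ (Set.Icc (-(m : ℤ)) m) := by
    intro i hi j hj hij
    have hi1 := hi.1
    have hj2 := hj.2
    rw [hζ]
    dsimp only
    split_ifs with h1 h2 h2
    · have e1 := hη i hi1 (by omega)
      have e2 := hη j (by omega) (by omega)
      have e3 := hmc' (a := i + 1) (b := j) ⟨by omega, by omega⟩ hj (by omega)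
      linarith [e1.2.1, e2.1]
    · have e1 := hη i hi1 (by omega)
      have e2 := hξ (j - 1) (by omega) (by omega)
      have e3 := hmc' (a := i + 1) (b := k + 1) ⟨by omega, by omega⟩ ⟨by omega, by omega⟩ (by omega)
      have e4 := hmc (a := k) (b := j - 1) ⟨by omega, by omega⟩ ⟨by omega, by omega⟩ (by omega)
      linarith [e1.2.1, e2.1]
    · omega
    · have e1 := hξ (i - 1) (by omega) (by omega)
      have e2 := hξ (j - 1) (by omega) (by omega)
      have e3 := hmc (a := i - 1 + 1) (b := j - 1) ⟨by omega, by omega⟩ ⟨by omega, by omega⟩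
        (by omega)
      linarith [e1.2.1, e2.1]
  have hcard := Finset.card_le_card_of_injOn ζ hζ0 (by
    rw [Finset.coe_Icc]
    exact hζmono.injOn)
  have h1 := ((derivative P).roots.toFinset_card_le.trans (card_roots' _)).trans
    (natDegree_derivative_le P)
  rw [h.natDegree_eq] at h1
  rw [Int.card_Icc] at hcard
  omega

theorem levelRoot_neg (h : IsBandPolynomial P m) {c : ℝ} (hc : |c| ≤ 4) {k : ℤ}
    (hk : k ∈ Set.Icc (-(m : ℤ)) m) : levelRoot P m (-c) (-k) = -levelRoot P m c k := by
  have hneg : ∀ k ∈ Set.Icc (-(m : ℤ)) m, -k ∈ Set.Icc (-(m : ℤ)) m := fun k hk =>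
    ⟨by linarith [hk.2], by linarith [hk.1]⟩
  obtain ⟨s, hs, hP⟩ := h.exists_roots (-c) (by rwa [abs_neg])
  have h1 := eq_levelRoot hs hP (f := fun k => -levelRoot P m c (-k)) ?_ ?_ (hneg k hk)
  · rw [← h1, neg_neg]
  · intro i hi j hj hij
    exact neg_lt_neg (h.strictMonoOn_levelRoot hc (hneg j hj) (hneg i hi) (by omega))
  · intro i hi
    have h2 := congrArg (eval (-levelRoot P m c (-i))) hP
    rw [eval_sub, eval_C, h.eval_neg, h.eval_levelRoot hc (hneg i hi), sub_self, eval_prod] at h2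
    obtain ⟨y, hy, hy'⟩ := Finset.prod_eq_zero_iff.1 h2.symm
    rw [eval_sub, eval_X, eval_C, sub_eq_zero] at hy'
    rwa [hy']

end IsBandPolynomial

/-- The sign of the slope of the polynomial on the band `k`. -/
noncomputable def bandSign (m : ℕ) (k : ℤ) : ℝ := (-1) ^ ((m : ℤ) - k)

theorem bandSign_eq_or (m : ℕ) (k : ℤ) : bandSign m k = 1 ∨ bandSign m k = -1 := by
  rcases Int.even_or_odd ((m : ℤ) - k) with h | h
  · exact Or.inl h.neg_one_zpow
  · exact Or.inr h.neg_one_zpow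

theorem bandSign_mul_self (m : ℕ) (k : ℤ) : bandSign m k * bandSign m k = 1 := by
  rcases bandSign_eq_or m k with h | h <;> rw [h] <;> norm_num

theorem abs_bandSign_mul (m : ℕ) (k : ℤ) (c : ℝ) : |bandSign m k * c| = |c| := by
  rcases bandSign_eq_or m k with h | h <;> rw [h] <;> simp

theorem bandSign_add_one (m : ℕ) (k : ℤ) : bandSign m (k + 1) = -bandSign m k := by
  rw [bandSign, bandSign, ← sub_sub, zpow_sub_one₀ (by norm_num)]
  norm_num

theorem bandSign_neg (m : ℕ) (k : ℤ) : bandSign m (-k) = bandSign m k := by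
  rw [bandSign, bandSign, show (m : ℤ) - -k = m - k + (k + k) by ring, zpow_add₀ (by norm_num),
    Even.neg_one_zpow ⟨k, rfl⟩, mul_one]

/-- The sign of a product of differences, when `x` lies between the `y i` with `i < k` and those
with `i > k`. -/
theorem bandSign_mul_prod_pos {m : ℕ} {k : ℤ} (hk : k ∈ Set.Icc (-(m : ℤ)) m) {x : ℝ} {y : ℤ → ℝ}
    (hl : ∀ i, -(m : ℤ) ≤ i → i < k → y i < x) (hr : ∀ i, k < i → i ≤ m → x < y i) :
    0 < bandSign m k * ∏ i ∈ (Finset.Icc (-(m : ℤ)) m).erase k, (x - y i) := by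
  have h1 : ∀ i ∈ (Finset.Icc (-(m : ℤ)) m).erase k,
      x - y i = (if k < i then -1 else 1) * |x - y i| := by
    intro i hi
    rw [Finset.mem_erase, Finset.mem_Icc] at hi
    split_ifs with hki
    · rw [abs_of_neg (by linarith [hr i hki hi.2.2])]
      ring
    · rw [abs_of_pos (by linarith [hl i hi.2.1 (by omega)])]
      ring
  have h2 : ∀ i ∈ (Finset.Icc (-(m : ℤ)) m).erase k, 0 < |x - y i| := by
    intro i hi
    rw [Finset.mem_erase, Finset.mem_Icc] at hi
    rw [abs_pos, sub_ne_zero]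
    rcases lt_or_gt_of_ne hi.1 with hki | hki
    · exact (hl i hi.2.1 hki).ne'
    · exact (hr i hki hi.2.2).ne
  have h3 : ((Finset.Icc (-(m : ℤ)) m).erase k).filter (k < ·) = Finset.Ioc k m := by
    have := hk.1
    ext i
    simp only [Finset.mem_filter, Finset.mem_erase, Finset.mem_Icc, Finset.mem_Ioc]
    omega
  have h4 : ∏ i ∈ (Finset.Icc (-(m : ℤ)) m).erase k, (if k < i then (-1 : ℝ) else 1)
      = bandSign m k := by
    rw [Finset.prod_ite, Finset.prod_const, Finset.prod_const_one, mul_one, h3, Int.card_Ioc,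
      bandSign, ← zpow_natCast, Int.toNat_of_nonneg (by linarith [hk.2])]
  rw [Finset.prod_congr rfl h1, Finset.prod_mul_distrib, h4, ← mul_assoc, bandSign_mul_self, one_mul]
  exact Finset.prod_pos h2

/-- The left edge of the band `k` of the set `|P| ≤ 4`. -/
noncomputable def lowerEdge (P : ℝ[X]) (m : ℕ) (k : ℤ) : ℝ := levelRoot P m (bandSign m k * -4) k

/-- The right edge of the band `k` of the set `|P| ≤ 4`. -/
noncomputable def upperEdge (P : ℝ[X]) (m : ℕ) (k : ℤ) : ℝ := levelRoot P m (bandSign m k * 4) k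

namespace IsBandPolynomial

variable {P : ℝ[X]} {m : ℕ}

/-- Near the band `k`, the polynomial crosses each level in the direction of `bandSign`. -/
theorem bandSign_mul_eval_sub (h : IsBandPolynomial P m) {c : ℝ} (hc : |c| ≤ 4) {k : ℤ}
    (hk : k ∈ Set.Icc (-(m : ℤ)) m) {x : ℝ}
    (hl : ∀ i, -(m : ℤ) ≤ i → i < k → levelRoot P m c i < x)
    (hr : ∀ i, k < i → i ≤ m → x < levelRoot P m c i) :
    ∃ t, 0 < t ∧ bandSign m k * (P.eval x - c) = (x - levelRoot P m c k) * t := by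
  refine ⟨_, bandSign_mul_prod_pos hk hl hr, ?_⟩
  rw [h.eval_sub_eq_prod hc, ← Finset.mul_prod_erase _ _ (Finset.mem_Icc.2 hk)]
  ring

theorem levelRoot_lt_of_lt (h : IsBandPolynomial P m) {a b : ℝ} (ha : |a| ≤ 4) (hb : |b| ≤ 4)
    (hab : a < b) {k : ℤ} (hk : k ∈ Set.Icc (-(m : ℤ)) m) :
    levelRoot P m (bandSign m k * a) k < levelRoot P m (bandSign m k * b) k := by
  have ha' : |bandSign m k * a| ≤ 4 := by rwa [abs_bandSign_mul]
  have hb' : |bandSign m k * b| ≤ 4 := by rwa [abs_bandSign_mul]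
  obtain ⟨t, ht, h1⟩ := h.bandSign_mul_eval_sub hb' hk (x := levelRoot P m (bandSign m k * a) k)
    (fun i hi hik => h.levelRoot_lt_levelRoot hb' ha' hi hk.2 hik)
    (fun i hki hi => h.levelRoot_lt_levelRoot ha' hb' hk.1 hi hki)
  rw [h.eval_levelRoot ha' hk, ← mul_sub, ← mul_assoc, bandSign_mul_self, one_mul] at h1
  by_contra! hle
  nlinarith

theorem levelRoot_le_of_le (h : IsBandPolynomial P m) {a b : ℝ} (ha : |a| ≤ 4) (hb : |b| ≤ 4)
    (hab : a ≤ b) {k : ℤ} (hk : k ∈ Set.Icc (-(m : ℤ)) m) :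
    levelRoot P m (bandSign m k * a) k ≤ levelRoot P m (bandSign m k * b) k := by
  rcases hab.eq_or_lt with rfl | hab
  · exact le_rfl
  · exact (h.levelRoot_lt_of_lt ha hb hab hk).le

theorem abs_bandSign_mul_four (m : ℕ) (k : ℤ) : |bandSign m k * 4| ≤ 4 := by
  rw [abs_bandSign_mul]
  norm_num

theorem abs_bandSign_mul_neg_four (m : ℕ) (k : ℤ) : |bandSign m k * -4| ≤ 4 := by
  rw [abs_bandSign_mul]
  norm_num

theorem lowerEdge_lt_center (h : IsBandPolynomial P m) {k : ℤ} (hk : k ∈ Set.Icc (-(m : ℤ)) m) :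
    lowerEdge P m k < levelRoot P m 0 k := by
  have := h.levelRoot_lt_of_lt (a := -4) (b := 0) (by norm_num) (by norm_num) (by norm_num) hk
  rwa [mul_zero] at this

theorem center_lt_upperEdge (h : IsBandPolynomial P m) {k : ℤ} (hk : k ∈ Set.Icc (-(m : ℤ)) m) :
    levelRoot P m 0 k < upperEdge P m k := by
  have := h.levelRoot_lt_of_lt (a := 0) (b := 4) (by norm_num) (by norm_num) (by norm_num) hk
  rwa [mul_zero] at this

theorem lowerEdge_lt_upperEdge (h : IsBandPolynomial P m) {k : ℤ}
    (hk : k ∈ Set.Icc (-(m : ℤ)) m) : lowerEdge P m k < upperEdge P m k :=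
  (h.lowerEdge_lt_center hk).trans (h.center_lt_upperEdge hk)

theorem upperEdge_lt_lowerEdge (h : IsBandPolynomial P m) {k l : ℤ} (hk : -(m : ℤ) ≤ k)
    (hl : l ≤ m) (hkl : k < l) : upperEdge P m k < lowerEdge P m l :=
  h.levelRoot_lt_levelRoot (abs_bandSign_mul_four m k) (abs_bandSign_mul_neg_four m l) hk hl hkl

theorem lowerEdge_le_lowerEdge (h : IsBandPolynomial P m) {k l : ℤ} (hk : -(m : ℤ) ≤ k)
    (hl : l ≤ m) (hkl : k ≤ l) : lowerEdge P m k ≤ lowerEdge P m l := by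
  rcases hkl.eq_or_lt with rfl | hkl
  · exact le_rfl
  · exact (h.levelRoot_lt_levelRoot (abs_bandSign_mul_neg_four m k)
      (abs_bandSign_mul_neg_four m l) hk hl hkl).le

theorem upperEdge_le_upperEdge (h : IsBandPolynomial P m) {k l : ℤ} (hk : -(m : ℤ) ≤ k)
    (hl : l ≤ m) (hkl : k ≤ l) : upperEdge P m k ≤ upperEdge P m l := by
  rcases hkl.eq_or_lt with rfl | hkl
  · exact le_rfl
  · exact (h.levelRoot_lt_levelRoot (abs_bandSign_mul_four m k)
      (abs_bandSign_mul_four m l) hk hl hkl).le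

theorem lowerEdge_neg (h : IsBandPolynomial P m) {k : ℤ} (hk : k ∈ Set.Icc (-(m : ℤ)) m) :
    lowerEdge P m (-k) = -upperEdge P m k := by
  rw [lowerEdge, upperEdge, ← h.levelRoot_neg (abs_bandSign_mul_four m k) hk, bandSign_neg, mul_neg]

theorem upperEdge_neg (h : IsBandPolynomial P m) {k : ℤ} (hk : k ∈ Set.Icc (-(m : ℤ)) m) :
    upperEdge P m (-k) = -lowerEdge P m k := by
  rw [lowerEdge, upperEdge, ← h.levelRoot_neg (abs_bandSign_mul_neg_four m k) hk, bandSign_neg,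
    mul_neg, neg_neg]

theorem center_zero (h : IsBandPolynomial P m) : levelRoot P m 0 0 = 0 := by
  have := h.levelRoot_neg (c := 0) (k := 0) (by norm_num) ⟨by omega, by omega⟩
  rw [neg_zero, neg_zero] at this
  linarith

/-- The set `|P| ≤ 4` is the union of the bands. -/
theorem abs_eval_le_iff (h : IsBandPolynomial P m) (x : ℝ) :
    |P.eval x| ≤ 4 ↔
      ∃ k ∈ Set.Icc (-(m : ℤ)) m, x ∈ Set.Icc (lowerEdge P m k) (upperEdge P m k) := by
  constructor
  · intro hx
    obtain ⟨k, hk, hxk⟩ := h.exists_eq_levelRoot hx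
    have hx' : |bandSign m k * P.eval x| ≤ 4 := by rwa [abs_bandSign_mul]
    have hxk' : x = levelRoot P m (bandSign m k * (bandSign m k * P.eval x)) k := by
      rw [← mul_assoc, bandSign_mul_self, one_mul]
      exact hxk
    have h1 := abs_le.1 hx'
    refine ⟨k, hk, ?_, ?_⟩
    · rw [hxk']
      exact h.levelRoot_le_of_le (by norm_num) hx' h1.1 hk
    · rw [hxk']
      exact h.levelRoot_le_of_le hx' (by norm_num) h1.2 hk
  · rintro ⟨k, hk, hxl, hxu⟩
    have hsep : ∀ c : ℝ, |c| ≤ 4 →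
        ∃ t, 0 < t ∧ bandSign m k * (P.eval x - c) = (x - levelRoot P m c k) * t := fun c hc =>
      h.bandSign_mul_eval_sub hc hk
        (fun i hi hik => (h.levelRoot_lt_levelRoot hc (abs_bandSign_mul_neg_four m k) hi hk.2
          hik).trans_le hxl)
        (fun i hki hi => hxu.trans_lt (h.levelRoot_lt_levelRoot (abs_bandSign_mul_four m k) hc hk.1
          hi hki))
    obtain ⟨t, ht, h1⟩ := hsep _ (abs_bandSign_mul_four m k)
    obtain ⟨t', ht', h2⟩ := hsep _ (abs_bandSign_mul_neg_four m k)
    rw [mul_sub, ← mul_assoc, bandSign_mul_self, one_mul] at h1 h2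
    have e1 : x - levelRoot P m (bandSign m k * 4) k ≤ 0 := sub_nonpos.2 hxu
    have e2 : 0 ≤ x - levelRoot P m (bandSign m k * -4) k := sub_nonneg.2 hxl
    rw [← abs_bandSign_mul m k, abs_le]
    constructor <;> nlinarith

/-- The connected component of the center of a band is the band. -/
theorem connectedComponentIn_center (h : IsBandPolynomial P m) {k : ℤ}
    (hk : k ∈ Set.Icc (-(m : ℤ)) m) :
    connectedComponentIn {x | |P.eval x| ≤ 4} (levelRoot P m 0 k) =
      Set.Icc (lowerEdge P m k) (upperEdge P m k) := by
  set S : Set ℝ := {x | |P.eval x| ≤ 4} with hS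
  have hsub : Set.Icc (lowerEdge P m k) (upperEdge P m k) ⊆ S := fun x hx =>
    (h.abs_eval_le_iff x).2 ⟨k, hk, hx⟩
  have hmem : levelRoot P m 0 k ∈ Set.Icc (lowerEdge P m k) (upperEdge P m k) :=
    ⟨(h.lowerEdge_lt_center hk).le, (h.center_lt_upperEdge hk).le⟩
  refine Set.Subset.antisymm (fun y hy => ?_)
    (isPreconnected_Icc.subset_connectedComponentIn hmem hsub)
  have hconn : (connectedComponentIn S (levelRoot P m 0 k)).OrdConnected :=
    isPreconnected_connectedComponentIn.ordConnected
  have hself := mem_connectedComponentIn (hsub hmem)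
  have hgap : ∀ i : ℤ, -(m : ℤ) ≤ i → i + 1 ≤ m →
      (upperEdge P m i + lowerEdge P m (i + 1)) / 2 ∉ S := by
    intro i hi hi' hmem
    have hlt := h.upperEdge_lt_lowerEdge hi hi' (by omega)
    obtain ⟨n, hn, hn1, hn2⟩ := (h.abs_eval_le_iff _).1 hmem
    rcases le_or_gt n i with hni | hni
    · linarith [h.upperEdge_le_upperEdge hn.1 (by omega) hni]
    · linarith [h.lowerEdge_le_lowerEdge (k := i + 1) (by omega) hn.2 (by omega)]
  obtain ⟨i, hi, hi1, hi2⟩ := (h.abs_eval_le_iff y).1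
    (show |P.eval y| ≤ 4 from connectedComponentIn_subset S _ hy)
  rcases lt_trichotomy i k with hik | rfl | hki
  · exfalso
    have e1 := h.upperEdge_lt_lowerEdge (k := i) (l := i + 1) hi.1 (by linarith [hk.2]) (by omega)
    have e2 := h.lowerEdge_le_lowerEdge (k := i + 1) (l := k) (by linarith [hi.1]) hk.2 (by omega)
    refine hgap i hi.1 (by linarith [hk.2]) (connectedComponentIn_subset _ _
      (hconn.out hy hself ⟨?_, ?_⟩))
    · linarith
    · linarith [hmem.1]
  · exact ⟨hi1, hi2⟩
  · exfalso
    have e1 := h.upperEdge_lt_lowerEdge (k := k) (l := k + 1) hk.1 (by linarith [hi.2]) (by omega)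
    have e2 := h.lowerEdge_le_lowerEdge (k := k + 1) (l := i) (by linarith [hk.1]) hi.2 (by omega)
    refine hgap k hk.1 (by linarith [hi.2]) (connectedComponentIn_subset _ _
      (hconn.out hself hy ⟨?_, ?_⟩))
    · linarith [hmem.2]
    · linarith

end IsBandPolynomial

/-- The polynomial `-σ` of the almost Mathieu operator. -/
theorem isBandPolynomial_neg_discriminant {p q m : ℕ} (hm : q = 2 * m + 1)
    (hpq : Nat.Coprime p q) : IsBandPolynomial (-discriminant p q) m := by
  have hodd : Odd q := ⟨m, hm⟩
  have hq0 : (q : ℝ) ≠ 0 := by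
    rw [hm]
    positivity
  have hneg := eval_neg_neg_discriminant hodd hpq
  have hphase : ∀ c : ℝ, 0 ≤ c → c ≤ 4 → ∃ φ : ℝ, c = 2 + 2 * Real.cos (q * φ) := by
    intro c h0 h4
    refine ⟨Real.arccos (c / 2 - 1) / q, ?_⟩
    rw [mul_div_cancel₀ _ hq0, Real.cos_arccos (by linarith) (by linarith)]
    ring
  have hpos : ∀ c : ℝ, 0 ≤ c → c ≤ 4 → ∃ s : Finset ℝ, s.card = q ∧
      -discriminant p q - C c = ∏ x ∈ s, (X - C x) ∧
        ∀ x ∈ s, 1 ≤ |(derivative (-discriminant p q)).eval x| := by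
    intro c h0 h4
    obtain ⟨φ, rfl⟩ := hphase c h0 h4
    obtain ⟨s, hs, hP, hd⟩ := exists_level_roots hodd hpq φ
    exact ⟨s, hs, hP, fun x hx => (hd x hx).1⟩
  have hder : ∀ x : ℝ, (derivative (-discriminant p q)).eval (-x) =
      (derivative (-discriminant p q)).eval x := by
    intro x
    have h1 : (-discriminant p q).comp (-X) = discriminant p q := by
      refine Polynomial.funext fun y => ?_
      have h2 := hneg y
      simp only [eval_comp, Polynomial.eval_neg, eval_X] at h2 ⊢
      linarith
    have h2 := congrArg (fun f => (derivative f).eval x) h1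
    simp only [derivative_comp, derivative_neg, derivative_X, eval_mul, Polynomial.eval_neg, eval_comp,
      eval_X, eval_one] at h2 ⊢
    linarith
  refine ⟨by rw [natDegree_neg_discriminant (by omega), hm], hneg, ?_, ?_⟩
  · intro c hc
    rw [abs_le] at hc
    rcases le_total 0 c with h0 | h0
    · obtain ⟨s, hs, hP, -⟩ := hpos c h0 hc.2
      exact ⟨s, hs.trans hm, hP⟩
    · obtain ⟨s, hs, hP, -⟩ := hpos (-c) (by linarith) (by linarith)
      refine ⟨s.map (Equiv.neg ℝ).toEmbedding, by rw [Finset.card_map, hs, hm], ?_⟩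
      refine Polynomial.funext fun x => ?_
      have h1 := congrArg (eval (-x)) hP
      rw [eval_sub, eval_C, hneg, eval_prod] at h1
      rw [eval_sub, eval_C, Finset.prod_map, eval_prod]
      have h2 : ∏ y ∈ s, eval x (X - C ((Equiv.neg ℝ).toEmbedding y)) =
          (-1) ^ s.card * ∏ y ∈ s, eval (-x) (X - C y) := by
        rw [← Finset.prod_const, ← Finset.prod_mul_distrib]
        refine Finset.prod_congr rfl fun y _ => ?_
        simp
        ring
      rw [h2, ← h1, hs, hodd.neg_one_pow]
      ring
  · intro x hx
    have hroot : ∀ x, 0 ≤ (-discriminant p q).eval x → (-discriminant p q).eval x ≤ 4 →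
        1 ≤ |(derivative (-discriminant p q)).eval x| := by
      intro x h0 h4
      obtain ⟨s, -, hP, hd⟩ := hpos _ h0 h4
      refine hd x ?_
      have h1 := congrArg (eval x) hP
      rw [eval_sub, eval_C, sub_self, eval_prod] at h1
      obtain ⟨y, hy, hxy⟩ := Finset.prod_eq_zero_iff.1 h1.symm
      rw [eval_sub, eval_X, eval_C, sub_eq_zero] at hxy
      rwa [hxy]
    rw [abs_le] at hx
    rcases le_total 0 ((-discriminant p q).eval x) with h0 | h0
    · exact hroot x h0 hx.2
    · rw [← hder]
      have := hneg x
      exact hroot (-x) (by linarith) (by linarith)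

/-! ### Gap estimates -/

namespace IsBandPolynomial

variable {P : ℝ[X]} {m : ℕ}

theorem lowerEdge_le_levelRoot (h : IsBandPolynomial P m) {c : ℝ} (hc : |c| ≤ 4) {k : ℤ}
    (hk : k ∈ Set.Icc (-(m : ℤ)) m) : lowerEdge P m k ≤ levelRoot P m c k := by
  have hc' : |bandSign m k * c| ≤ 4 := by rwa [abs_bandSign_mul]
  have := h.levelRoot_le_of_le (by norm_num) hc' (abs_le.1 hc').1 hk
  rwa [← mul_assoc, bandSign_mul_self, one_mul] at this

theorem levelRoot_le_upperEdge (h : IsBandPolynomial P m) {c : ℝ} (hc : |c| ≤ 4) {k : ℤ}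
    (hk : k ∈ Set.Icc (-(m : ℤ)) m) : levelRoot P m c k ≤ upperEdge P m k := by
  have hc' : |bandSign m k * c| ≤ 4 := by rwa [abs_bandSign_mul]
  have := h.levelRoot_le_of_le hc' (by norm_num) (abs_le.1 hc').2 hk
  rwa [← mul_assoc, bandSign_mul_self, one_mul] at this

/-- The two edges of a gap belong to the same level. -/
theorem lowerEdge_add_one (P : ℝ[X]) (m : ℕ) (j : ℤ) :
    lowerEdge P m (j + 1) = levelRoot P m (bandSign m j * 4) (j + 1) := by
  rw [lowerEdge, bandSign_add_one, neg_mul_neg]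

theorem eval_derivative_levelRoot (h : IsBandPolynomial P m) {c : ℝ} (hc : |c| ≤ 4) {j : ℤ}
    (hj : j ∈ Set.Icc (-(m : ℤ)) m) : (derivative P).eval (levelRoot P m c j) =
      ∏ k ∈ (Finset.Icc (-(m : ℤ)) m).erase j, (levelRoot P m c j - levelRoot P m c k) := by
  have h1 : derivative P = derivative (P - C c) := by simp
  rw [h1, h.sub_C_eq_prod hc, ← Finset.mul_prod_erase _ _ (Finset.mem_Icc.2 hj), derivative_mul,
    derivative_X_sub_C]
  simp [eval_prod]

/-- Comparison of the product of the distances from the edge `upperEdge j` to the other points of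
its level with the product of the distances from a zero `z ≥ 0` of `P`, which is `4`. A factor
`k ≥ j + 2` and the factor `-(k + 1)` together do not exceed the corresponding factors for `z`; the
remaining `2j + 2` factors `-(j + 2), …, j - 1` are bounded by `β`. -/
theorem sq_sub_lt_mul_gap (h : IsBandPolynomial P m) {j : ℤ} (hj0 : 0 ≤ j) (hjm : j < m) {z : ℝ}
    (hz : P.eval z = 0) (hz0 : 0 ≤ z) (hzU : z < upperEdge P m j) {β : ℤ → ℝ} (hβ1 : ∀ k, 1 ≤ β k)
    (hβ : ∀ k ∈ Set.Icc (-(j + 2)) (j - 1), -(m : ℤ) ≤ k →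
      |upperEdge P m j - levelRoot P m (bandSign m j * 4) k| ≤
        β k * |z - levelRoot P m (bandSign m j * 4) k|) :
    (upperEdge P m j - z) ^ 2 < 4 * (∏ k ∈ Finset.Icc (-(j + 2)) (j - 1), β k) *
      (lowerEdge P m (j + 1) - upperEdge P m j) := by
  have hc := abs_bandSign_mul_four m j
  set c := bandSign m j * 4 with hcdef
  set ν : ℤ → ℝ := levelRoot P m c with hν
  set U := upperEdge P m j with hU
  have hνj : ν j = U := rfl
  have hνj1 : ν (j + 1) = lowerEdge P m (j + 1) := (lowerEdge_add_one P m j).symm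
  have hmono := h.strictMonoOn_levelRoot hc
  have hjI : j ∈ Set.Icc (-(m : ℤ)) m := ⟨by omega, by omega⟩
  have hj1I : j + 1 ∈ Set.Icc (-(m : ℤ)) m := ⟨by omega, by omega⟩
  have hgap : U < ν (j + 1) := hmono hjI hj1I (by omega)
  have hright : ∀ k, j + 2 ≤ k → k ≤ m → U < ν k := fun k hk hkm =>
    hmono hjI ⟨by omega, hkm⟩ (by omega)
  have hrefl : ∀ k, j + 2 ≤ k → k < m → ν k < -ν (-(k + 1)) := by
    intro k hk hkm
    have hk1 : k + 1 ∈ Set.Icc (-(m : ℤ)) m := ⟨by omega, by omega⟩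
    have hc' : |-c| ≤ 4 := by rwa [abs_neg]
    have h1 := h.levelRoot_neg hc' hk1
    rw [neg_neg] at h1
    rw [hν, h1, neg_neg]
    exact h.levelRoot_lt_levelRoot hc hc' (by omega) (by omega) (by omega)
  set I := Finset.Icc (-(m : ℤ)) m with hI
  set A := (Finset.Icc (-(j + 2)) (j - 1)).filter (-(m : ℤ) ≤ ·) with hA
  set R := Finset.Icc (j + 2) (m : ℤ) with hR
  set R' := Finset.Icc (j + 2) ((m : ℤ) - 1) with hR'
  set L := Finset.Icc (-(m : ℤ)) (-(j + 3)) with hL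
  set T := (I.erase j).erase (j + 1) with hT
  have hTsplit : T = A ∪ (L ∪ R) := by
    ext k
    simp only [hT, hI, hA, hL, hR, Finset.mem_erase, Finset.mem_Icc, Finset.mem_union,
      Finset.mem_filter]
    omega
  have hdisj1 : Disjoint A (L ∪ R) := by
    rw [Finset.disjoint_left]
    intro k hk hk'
    simp only [hA, hL, hR, Finset.mem_Icc, Finset.mem_union, Finset.mem_filter] at hk hk'
    omega
  have hdisj2 : Disjoint L R := by
    rw [Finset.disjoint_left]
    intro k hk hk'
    simp only [hL, hR, Finset.mem_Icc] at hk hk'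
    omega
  have hsplit : ∀ F : ℤ → ℝ, ∏ k ∈ T, F k = (∏ k ∈ A, F k) * ((∏ k ∈ L, F k) * ∏ k ∈ R, F k) := by
    intro F
    rw [hTsplit, Finset.prod_union hdisj1, Finset.prod_union hdisj2]
  have hLR' : ∀ F : ℤ → ℝ, ∏ k ∈ L, F k = ∏ k ∈ R', F (-(k + 1)) := by
    intro F
    refine Finset.prod_nbij' (fun k => -(k + 1)) (fun k => -(k + 1)) ?_ ?_ ?_ ?_ ?_
    · intro k hk
      simp only [hL, hR', Finset.mem_Icc] at hk ⊢
      omega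
    · intro k hk
      simp only [hL, hR', Finset.mem_Icc] at hk ⊢
      omega
    · intro k _
      ring
    · intro k _
      ring
    · intro k _
      congr 1
      ring
  set F : ℤ → ℝ := fun k => |U - ν k| with hF
  set G : ℤ → ℝ := fun k => |z - ν k| with hG
  have hF0 : ∀ k, 0 ≤ F k := fun k => abs_nonneg _
  have hG0 : ∀ k, 0 ≤ G k := fun k => abs_nonneg _
  have hFR : ∀ k, j + 2 ≤ k → k ≤ m → F k = ν k - U ∧ G k = ν k - z := by
    intro k hk hkm
    have h1 := hright k hk hkm
    refine ⟨?_, ?_⟩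
    · rw [hF]
      dsimp only
      rw [abs_of_neg (by linarith), neg_sub]
    · rw [hG]
      dsimp only
      rw [abs_of_neg (by linarith), neg_sub]
  have hpair : ∀ k ∈ R', F (-(k + 1)) * F k ≤ G (-(k + 1)) * G k := by
    intro k hk
    rw [hR', Finset.mem_Icc] at hk
    have h1 := hright k hk.1 (by omega)
    have h2 := hrefl k hk.1 (by omega)
    obtain ⟨e1, e2⟩ := hFR k hk.1 (by omega)
    have e3 : F (-(k + 1)) = U - ν (-(k + 1)) := abs_of_pos (by linarith)
    have e4 : G (-(k + 1)) = z - ν (-(k + 1)) := abs_of_pos (by linarith)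
    rw [e1, e2, e3, e4]
    have hw : 0 < U - z := by linarith
    nlinarith [mul_nonneg hw.le (by linarith : 0 ≤ U - z + (z - ν (-(k + 1))) - (ν k - z))]
  have hLRle : (∏ k ∈ L, F k) * ∏ k ∈ R, F k ≤ (∏ k ∈ L, G k) * ∏ k ∈ R, G k := by
    rw [hLR', hLR']
    rcases lt_or_ge (m : ℤ) (j + 2) with hm | hm
    · have h1 : R = ∅ := Finset.Icc_eq_empty (by omega)
      have h2 : R' = ∅ := Finset.Icc_eq_empty (by omega)
      rw [h1, h2]
      simp
    · have h1 : R = insert (m : ℤ) R' := by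
        ext k
        simp only [hR, hR', Finset.mem_Icc, Finset.mem_insert]
        omega
      have h2 : (m : ℤ) ∉ R' := by
        simp only [hR', Finset.mem_Icc]
        omega
      obtain ⟨e1, e2⟩ := hFR m hm le_rfl
      have hFm : F m ≤ G m := by
        rw [e1, e2]
        linarith
      rw [h1, Finset.prod_insert h2, Finset.prod_insert h2, mul_left_comm, mul_left_comm _ (G m),
        ← Finset.prod_mul_distrib, ← Finset.prod_mul_distrib]
      exact mul_le_mul hFm
        (Finset.prod_le_prod (fun k _ => mul_nonneg (hF0 _) (hF0 _)) hpair)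
        (Finset.prod_nonneg fun k _ => mul_nonneg (hF0 _) (hF0 _)) (hG0 _)
  have hβA : ∏ k ∈ A, β k ≤ ∏ k ∈ Finset.Icc (-(j + 2)) (j - 1), β k := by
    rw [hA, Finset.prod_filter]
    refine Finset.prod_le_prod (fun k _ => ?_) fun k _ => ?_
    · split_ifs
      · linarith [hβ1 k]
      · norm_num
    · split_ifs
      · exact le_rfl
      · exact hβ1 k
  have hAle : ∏ k ∈ A, F k ≤ (∏ k ∈ Finset.Icc (-(j + 2)) (j - 1), β k) * ∏ k ∈ A, G k := by
    refine le_trans ?_ (mul_le_mul_of_nonneg_right hβA (Finset.prod_nonneg fun k _ => hG0 k))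
    rw [← Finset.prod_mul_distrib]
    refine Finset.prod_le_prod (fun k _ => hF0 k) fun k hk => ?_
    rw [hA, Finset.mem_filter, Finset.mem_Icc] at hk
    exact hβ k hk.1 hk.2
  set B := ∏ k ∈ Finset.Icc (-(j + 2)) (j - 1), β k with hB
  have hB0 : 0 ≤ B := Finset.prod_nonneg fun k _ => by linarith [hβ1 k]
  have hTle : ∏ k ∈ T, F k ≤ B * ∏ k ∈ T, G k := by
    rw [hsplit, hsplit, ← mul_assoc B]
    exact mul_le_mul hAle hLRle
      (mul_nonneg (Finset.prod_nonneg fun k _ => hF0 k) (Finset.prod_nonneg fun k _ => hF0 k))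
      (mul_nonneg hB0 (Finset.prod_nonneg fun k _ => hG0 k))
  have hj1mem : j + 1 ∈ I.erase j := by
    rw [Finset.mem_erase, hI, Finset.mem_Icc]
    omega
  have hjmem : j ∈ I := Finset.mem_Icc.2 hjI
  -- The derivative at the edge of the gap contains the length of the gap as a factor.
  have hderiv : 1 ≤ (ν (j + 1) - U) * ∏ k ∈ T, F k := by
    have h1 := h.one_le_abs_derivative (ν j) (by rw [h.eval_levelRoot hc hjI]; exact hc)
    rw [h.eval_derivative_levelRoot hc hjI, Finset.abs_prod, ← Finset.mul_prod_erase _ _ hj1mem,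
      abs_sub_comm] at h1
    rwa [abs_of_pos (by rw [← hν, hνj]; linarith : 0 < levelRoot P m c (j + 1) - levelRoot P m c j)]
      at h1
  have hfour : 4 = (U - z) * ((ν (j + 1) - z) * ∏ k ∈ T, G k) := by
    have h1 := congrArg abs (h.eval_sub_eq_prod hc z)
    rw [hz, zero_sub, abs_neg, hcdef, abs_bandSign_mul, Finset.abs_prod,
      ← Finset.mul_prod_erase _ _ hjmem, ← Finset.mul_prod_erase _ _ hj1mem, ← hcdef,
      abs_of_neg (by rw [← hν, hνj]; linarith : z - levelRoot P m c j < 0),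
      abs_of_neg (by rw [← hν]; linarith : z - levelRoot P m c (j + 1) < 0), neg_sub, neg_sub] at h1
    rw [abs_of_pos (by norm_num : (0 : ℝ) < 4)] at h1
    exact h1
  rw [← hνj1]
  have hw : 0 < U - z := by linarith
  have hGpos : 0 < ∏ k ∈ T, G k := by
    have h1 : 0 < (U - z) * ((ν (j + 1) - z) * ∏ k ∈ T, G k) := by rw [← hfour]; norm_num
    exact pos_of_mul_pos_right (pos_of_mul_pos_right h1 hw.le) (by linarith)
  have hΔ : 0 < ν (j + 1) - U := by linarith
  have h1 : 1 ≤ (ν (j + 1) - U) * (B * ∏ k ∈ T, G k) :=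
    hderiv.trans (mul_le_mul_of_nonneg_left hTle hΔ.le)
  have h2 : (U - z) * (ν (j + 1) - z) ≤ 4 * B * (ν (j + 1) - U) := by
    have h3 : (U - z) * (ν (j + 1) - z) * 1 ≤
        (U - z) * (ν (j + 1) - z) * ((ν (j + 1) - U) * (B * ∏ k ∈ T, G k)) :=
      mul_le_mul_of_nonneg_left h1 (mul_nonneg hw.le (by linarith))
    calc (U - z) * (ν (j + 1) - z) = (U - z) * (ν (j + 1) - z) * 1 := by ring
      _ ≤ _ := h3
      _ = ((U - z) * ((ν (j + 1) - z) * ∏ k ∈ T, G k)) * B * (ν (j + 1) - U) := by ring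
      _ = 4 * B * (ν (j + 1) - U) := by rw [← hfour]
  nlinarith

/-- The central gap. -/
theorem sq_upperEdge_zero_lt (h : IsBandPolynomial P m) (hm : 0 < m) :
    upperEdge P m 0 ^ 2 < 16 * (lowerEdge P m 1 - upperEdge P m 0) := by
  have h0 : (0 : ℤ) ∈ Set.Icc (-(m : ℤ)) m := ⟨by omega, by omega⟩
  have h1 : (1 : ℤ) ∈ Set.Icc (-(m : ℤ)) m := ⟨by omega, by omega⟩
  have hU : 0 < upperEdge P m 0 := h.center_zero ▸ h.center_lt_upperEdge h0
  have hz : P.eval 0 = 0 := by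
    simpa only [h.center_zero] using h.eval_levelRoot (c := 0) (by norm_num) h0
  have key := h.sq_sub_lt_mul_gap le_rfl (by omega) hz le_rfl hU (β := fun _ => 2)
    (fun _ => by norm_num) ?_
  · rw [Finset.prod_const, Int.card_Icc, show ((0 : ℤ) - 1 + 1 - -(0 + 2)).toNat = 2 from rfl,
      sub_zero, zero_add] at key
    linarith
  · -- The points `-2` and `-1` of the level are at least as far from `0` as the edge.
    intro k hk hkm
    have hk2 := hk.2
    have hkI : k ∈ Set.Icc (-(m : ℤ)) m := ⟨hkm, by omega⟩
    have e1 := h.levelRoot_le_upperEdge (abs_bandSign_mul_four m 0) hkI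
    have e2 := h.upperEdge_le_upperEdge (k := k) (l := -1) hkm (by omega) (by omega)
    have e3 := h.upperEdge_neg h1
    have e4 := h.upperEdge_lt_lowerEdge (k := 0) (l := 1) (by omega) (by omega) (by omega)
    rw [abs_of_pos (by linarith), abs_of_pos (by linarith)]
    linarith

/-- If the part of the band `j` to the right of its center is at most `D - 1` times the part to the
left, then the gap to the right of the band is bounded below in terms of its width. -/
theorem sq_width_lt (h : IsBandPolynomial P m) {j : ℕ} (hjm : j < m) {D : ℝ} (hD1 : 1 ≤ D)
    (hD : upperEdge P m j - levelRoot P m 0 j ≤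
      (D - 1) * (levelRoot P m 0 j - lowerEdge P m j)) :
    (upperEdge P m j - levelRoot P m 0 j) ^ 2 <
      4 * D ^ (2 * (j + 1)) * (lowerEdge P m (j + 1) - upperEdge P m j) := by
  have h0 : (0 : ℤ) ∈ Set.Icc (-(m : ℤ)) m := ⟨by omega, by omega⟩
  have hjI : (j : ℤ) ∈ Set.Icc (-(m : ℤ)) m := ⟨by omega, by omega⟩
  have hz0 : 0 ≤ levelRoot P m 0 j := by
    have h1 := (h.strictMonoOn_levelRoot (c := 0) (by norm_num)).monotoneOn h0 hjI (by omega)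
    rwa [h.center_zero] at h1
  have key := h.sq_sub_lt_mul_gap (j := j) (by omega) (by omega)
    (h.eval_levelRoot (c := 0) (by norm_num) hjI) hz0 (h.center_lt_upperEdge hjI) (β := fun _ => D)
    (fun _ => hD1) ?_
  · rw [Finset.prod_const, Int.card_Icc,
      show ((j : ℤ) - 1 + 1 - -((j : ℤ) + 2)).toNat = 2 * (j + 1) by omega] at key
    exact key
  · -- These points lie to the left of the band, so their distance from its center is at least the
    -- width of its left part.
    intro k hk hkm
    have hk2 := hk.2
    have hkI : k ∈ Set.Icc (-(m : ℤ)) m := ⟨hkm, by omega⟩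
    have e1 := h.levelRoot_le_upperEdge (abs_bandSign_mul_four m j) hkI
    have e2 := h.upperEdge_lt_lowerEdge (k := k) (l := j) hkm (by omega) (by omega)
    have e3 := h.lowerEdge_lt_center hjI
    have e4 := h.center_lt_upperEdge hjI
    rw [abs_of_pos (by linarith), abs_of_pos (by linarith)]
    nlinarith

/-- The gap to the right of the band `j ≥ 1` in terms of the width of the central band. -/
theorem pow_upperEdge_zero_lt (h : IsBandPolynomial P m) {j : ℕ} (hj : 1 ≤ j) (hjm : j < m)
    (hU4 : upperEdge P m j ≤ 4) :
    (upperEdge P m 0 / 8) ^ (2 * j) < lowerEdge P m (j + 1) - upperEdge P m j := by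
  have h0 : (0 : ℤ) ∈ Set.Icc (-(m : ℤ)) m := ⟨by omega, by omega⟩
  have h1 : (1 : ℤ) ∈ Set.Icc (-(m : ℤ)) m := ⟨by omega, by omega⟩
  have hjI : (j : ℤ) ∈ Set.Icc (-(m : ℤ)) m := ⟨by omega, by omega⟩
  have hj1I : (j : ℤ) + 1 ∈ Set.Icc (-(m : ℤ)) m := ⟨by omega, by omega⟩
  have hU0 : 0 < upperEdge P m 0 := h.center_zero ▸ h.center_lt_upperEdge h0
  have hU0j : upperEdge P m 0 ≤ upperEdge P m j :=
    h.upperEdge_le_upperEdge (by omega) (by omega) (by omega)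
  have hz : P.eval 0 = 0 := by
    simpa only [h.center_zero] using h.eval_levelRoot (c := 0) (by norm_num) h0
  have hc := abs_bandSign_mul_four m j
  set u := upperEdge P m j with hu
  set w := upperEdge P m 0 with hw
  have hupos : 0 < u := by linarith
  have hratio : 1 ≤ 2 * u / w := by
    rw [le_div_iff₀ hU0]
    linarith
  -- The points of the level nearest to the origin have modulus at least `w`.
  have hfar : ∀ k ∈ Set.Icc (-(m : ℤ)) m, w ≤ |levelRoot P m (bandSign m j * 4) k| := by
    intro k hk
    have e1 := h.levelRoot_le_upperEdge hc hk
    have e2 := h.lowerEdge_le_levelRoot hc hk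
    have e3 := h.upperEdge_lt_lowerEdge (k := 0) (l := 1) (by omega) (by omega) (by omega)
    rcases lt_trichotomy k 0 with hk0 | rfl | hk0
    · have e4 := h.upperEdge_le_upperEdge (k := k) (l := -1) hk.1 (by omega) (by omega)
      rw [h.upperEdge_neg h1] at e4
      rw [abs_of_neg (by linarith)]
      linarith
    · have e5 := h.lowerEdge_neg h0
      rw [neg_zero] at e5
      have e6 : levelRoot P m (bandSign m j * 4) 0 = w ∨
          levelRoot P m (bandSign m j * 4) 0 = -w := by
        rcases bandSign_eq_or m j with hs | hs <;> rcases bandSign_eq_or m 0 with hs' | hs'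
        · left; rw [hs, hw, upperEdge, hs']
        · right; rw [hs, hw, ← e5, lowerEdge, hs']; norm_num
        · right; rw [hs, hw, ← e5, lowerEdge, hs']; norm_num
        · left; rw [hs, hw, upperEdge, hs']
      rcases e6 with e6 | e6 <;> rw [e6]
      · exact le_abs_self w
      · rw [abs_neg]
        exact le_abs_self w
    · have e4 := h.lowerEdge_le_lowerEdge (k := 1) (l := k) (by omega) hk.2 (by omega)
      rw [abs_of_pos (by linarith)]
      linarith
  -- The points `-(j + 2)` and `-(j + 1)` are farther than `u` from `0` on its left; the `2j` points
  -- between them and `u` are within `2u` of `u` and at least `w` from `0`.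
  have key := h.sq_sub_lt_mul_gap (j := j) (by omega) (by omega) hz le_rfl hupos
    (β := fun k => if k < -(j : ℤ) then 2 else 2 * u / w) ?_ ?_
  · have hprod : ∏ k ∈ Finset.Icc (-((j : ℤ) + 2)) ((j : ℤ) - 1),
        (if k < -(j : ℤ) then 2 else 2 * u / w) = 2 ^ 2 * (2 * u / w) ^ (2 * j) := by
      have f1 : (Finset.Icc (-((j : ℤ) + 2)) ((j : ℤ) - 1)).filter (· < -(j : ℤ)) =
          Finset.Icc (-((j : ℤ) + 2)) (-(j : ℤ) - 1) := by
        ext k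
        simp only [Finset.mem_filter, Finset.mem_Icc]
        omega
      have f2 : (Finset.Icc (-((j : ℤ) + 2)) ((j : ℤ) - 1)).filter (¬ · < -(j : ℤ)) =
          Finset.Icc (-(j : ℤ)) ((j : ℤ) - 1) := by
        ext k
        simp only [Finset.mem_filter, Finset.mem_Icc]
        omega
      rw [Finset.prod_ite, f1, f2, Finset.prod_const, Finset.prod_const, Int.card_Icc, Int.card_Icc,
        show (-(j : ℤ) - 1 + 1 - -((j : ℤ) + 2)).toNat = 2 by omega,
        show ((j : ℤ) - 1 + 1 - -(j : ℤ)).toNat = 2 * j by omega]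
    rw [hprod, sub_zero] at key
    set Δ := lowerEdge P m (j + 1) - u with hΔ
    have hΔ0 : 0 < Δ := sub_pos.2 (h.upperEdge_lt_lowerEdge (by omega) (by omega) (by omega))
    obtain ⟨i, rfl⟩ := Nat.exists_eq_add_of_le hj
    have hu2 : (u ^ 2) ^ i ≤ 16 ^ i := pow_le_pow_left₀ (by positivity) (by nlinarith) i
    have hwpow : 0 < w ^ (2 * (1 + i)) := by positivity
    have k1 : u ^ 2 * w ^ (2 * (1 + i)) < u ^ 2 * (64 * 4 ^ i * (u ^ 2) ^ i * Δ) := by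
      have := mul_lt_mul_of_pos_right key hwpow
      calc u ^ 2 * w ^ (2 * (1 + i)) < _ := this
        _ = u ^ 2 * (64 * 4 ^ i * (u ^ 2) ^ i * Δ) := by
          rw [div_pow]
          field_simp
          rw [mul_pow, pow_mul 2, pow_add (2 ^ 2) 1 i, mul_add, pow_add u, pow_mul u 2 i]
          norm_num
          ring
    have k2 := lt_of_mul_lt_mul_left k1 (by positivity)
    rw [div_pow, div_lt_iff₀ (by positivity)]
    calc w ^ (2 * (1 + i)) < 64 * 4 ^ i * (u ^ 2) ^ i * Δ := k2
      _ ≤ 64 * 4 ^ i * 16 ^ i * Δ := by gcongr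
      _ = Δ * 8 ^ (2 * (1 + i)) := by
        rw [pow_mul, pow_add, mul_assoc 64, ← mul_pow]
        norm_num
        ring
  · intro k
    split_ifs
    · norm_num
    · exact hratio
  · intro k hk hkm
    have hk2 := hk.2
    have hkI : k ∈ Set.Icc (-(m : ℤ)) m := ⟨hkm, by omega⟩
    have e1 := h.levelRoot_le_upperEdge hc hkI
    have e2 := h.lowerEdge_le_levelRoot hc hkI
    rw [zero_sub, abs_neg]
    split_ifs with hkj
    · have e3 := h.upperEdge_le_upperEdge (k := k) (l := -((j : ℤ) + 1)) hkm (by omega) (by omega)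
      rw [h.upperEdge_neg hj1I] at e3
      have e4 := h.upperEdge_lt_lowerEdge (k := j) (l := j + 1) (by omega) (by omega) (by omega)
      rw [abs_of_pos (by linarith), abs_of_neg (by linarith)]
      linarith
    · have e3 := h.upperEdge_le_upperEdge (k := k) (l := j) hkm (by omega) (by omega)
      have e4 := h.lowerEdge_le_lowerEdge (k := -(j : ℤ)) (l := k) (by omega) hkI.2 (by omega)
      rw [h.lowerEdge_neg hjI] at e4
      have e5 := hfar k hkI
      rw [abs_of_nonneg (by linarith), div_mul_eq_mul_div, le_div_iff₀ hU0]
      nlinarith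

/-- The ratio `ρ` of the two parts of a band satisfies `ρ ≤ exp (1 + 1/ρ)`: the polynomial divided
by its central factor is a product to which `1 + x ≤ exp x` applies, and its logarithmic derivative
is controlled because the polynomial is monotone up to the edge of the band. -/
theorem width_le_mul_exp (h : IsBandPolynomial P m) {j : ℤ} (hj : j ∈ Set.Icc (-(m : ℤ)) m) :
    upperEdge P m j - levelRoot P m 0 j ≤ (levelRoot P m 0 j - lowerEdge P m j) *
      Real.exp ((upperEdge P m j - lowerEdge P m j) / (upperEdge P m j - levelRoot P m 0 j)) := by
  have h04 : |(0 : ℝ)| ≤ 4 := by norm_num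
  set c : ℤ → ℝ := levelRoot P m 0 with hc
  set r := upperEdge P m j with hr
  set l := lowerEdge P m j with hl
  have hlc : l < c j := h.lowerEdge_lt_center hj
  have hcr : c j < r := h.center_lt_upperEdge hj
  set I := Finset.Icc (-(m : ℤ)) m with hI
  have hjmem : j ∈ I := Finset.mem_Icc.2 hj
  have hσ := abs_bandSign_mul_four m j
  have hσ' := abs_bandSign_mul_neg_four m j
  have hPr : P.eval r = bandSign m j * 4 := h.eval_levelRoot hσ hj
  have hPl : P.eval l = bandSign m j * -4 := h.eval_levelRoot hσ' hj
  have hprod : ∀ x, P.eval x = ∏ k ∈ I, (x - c k) := by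
    intro x
    rw [← h.eval_sub_eq_prod h04, sub_zero]
  -- All centers other than `c j` lie on the same side of `l` and `r`.
  have hside : ∀ k ∈ I.erase j, (c k < l ∧ c k < r) ∨ (l < c k ∧ r < c k) := by
    intro k hk
    rw [Finset.mem_erase, hI, Finset.mem_Icc] at hk
    rcases lt_or_gt_of_ne hk.1 with hkj | hkj
    · exact Or.inl ⟨h.levelRoot_lt_levelRoot h04 hσ' hk.2.1 hj.2 hkj,
        h.levelRoot_lt_levelRoot h04 hσ hk.2.1 hj.2 hkj⟩
    · exact Or.inr ⟨h.levelRoot_lt_levelRoot hσ' h04 hj.1 hk.2.2 hkj,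
        h.levelRoot_lt_levelRoot hσ h04 hj.1 hk.2.2 hkj⟩
  have hrne : ∀ k ∈ I.erase j, r - c k ≠ 0 := by
    intro k hk
    rcases hside k hk with h1 | h1
    · exact sub_ne_zero.2 h1.2.ne'
    · exact sub_ne_zero.2 h1.2.ne
  have hrne' : ∀ k ∈ I, r - c k ≠ 0 := by
    intro k hk
    by_cases hkj : k = j
    · rw [hkj]
      exact sub_ne_zero.2 hcr.ne'
    · exact hrne k (Finset.mem_erase.2 ⟨hkj, hk⟩)
  have hderiv : (derivative P).eval r = P.eval r * ∑ k ∈ I, 1 / (r - c k) := by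
    have h1 := h.sub_C_eq_prod h04
    rw [C_0, sub_zero] at h1
    rw [hprod r, h1, derivative_prod_finset, eval_finsetSum, Finset.mul_sum]
    refine Finset.sum_congr rfl fun k hk => ?_
    rw [derivative_X_sub_C, mul_one, eval_prod, ← Finset.mul_prod_erase I _ hk]
    have := hrne' k hk
    simp only [eval_sub, eval_X, eval_C]
    field_simp
    rfl
  have hsum : 0 ≤ ∑ k ∈ I, 1 / (r - c k) := by
    have h1 : 0 < bandSign m j * (derivative P).eval r := by
      rw [hr, upperEdge, h.eval_derivative_levelRoot hσ hj]
      exact bandSign_mul_prod_pos hj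
        (fun i hi hij => h.strictMonoOn_levelRoot hσ ⟨hi, by have := hj.2; omega⟩ hj hij)
        (fun i hij hi => h.strictMonoOn_levelRoot hσ hj ⟨by have := hj.1; omega, hi⟩ hij)
    rw [hderiv, hPr, ← mul_assoc, ← mul_assoc, bandSign_mul_self] at h1
    linarith
  rw [← Finset.add_sum_erase I _ hjmem] at hsum
  have hratio : ∏ k ∈ I.erase j, ((l - c k) / (r - c k)) ≤ Real.exp ((r - l) / (r - c j)) := by
    calc ∏ k ∈ I.erase j, ((l - c k) / (r - c k))
        ≤ ∏ k ∈ I.erase j, Real.exp (-(r - l) * (1 / (r - c k))) := by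
          refine Finset.prod_le_prod (fun k hk => ?_) fun k hk => ?_
          · rcases hside k hk with h1 | h1
            · exact div_nonneg (by linarith [h1.1]) (by linarith [h1.2])
            · exact div_nonneg_of_nonpos (by linarith [h1.1]) (by linarith [h1.2])
          · have h1 := Real.add_one_le_exp (-(r - l) * (1 / (r - c k)))
            have h2 : (l - c k) / (r - c k) = -(r - l) * (1 / (r - c k)) + 1 := by
              have := hrne k hk
              field_simp
              ring
            rwa [h2]
      _ = Real.exp (-(r - l) * ∑ k ∈ I.erase j, 1 / (r - c k)) := by
          rw [← Real.exp_sum, Finset.mul_sum]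
      _ ≤ Real.exp ((r - l) / (r - c j)) := by
          refine Real.exp_le_exp.2 ?_
          rw [div_eq_mul_one_div]
          nlinarith
  have hGr : ∏ k ∈ I.erase j, (r - c k) ≠ 0 := Finset.prod_ne_zero_iff.2 hrne
  rw [Finset.prod_div_distrib] at hratio
  have e1 := hprod r
  have e2 := hprod l
  rw [hPr, ← Finset.mul_prod_erase I _ hjmem] at e1
  rw [hPl, ← Finset.mul_prod_erase I _ hjmem] at e2
  have e3 : r - c j =
      (c j - l) * ((∏ k ∈ I.erase j, (l - c k)) / ∏ k ∈ I.erase j, (r - c k)) := by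
    field_simp
    linarith
  calc r - c j = _ := e3
    _ ≤ _ := mul_le_mul_of_nonneg_left hratio (by linarith)

end IsBandPolynomial

theorem sqrt_five_bounds : 2.23606 < Real.sqrt 5 ∧ Real.sqrt 5 < 2.23607 :=
  ⟨Real.lt_sqrt_of_sq_lt (by norm_num), (Real.sqrt_lt' (by norm_num)).2 (by norm_num)⟩

theorem gapConst_bounds : 5.398 ≤ gapConst ∧ gapConst < 5.399 := by
  obtain ⟨h1, h2⟩ := sqrt_five_bounds
  have h3 := Real.exp_one_gt_d9
  have h4 := Real.exp_one_lt_d9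
  have h5 : 0 < Real.sqrt 5 - 1 := by linarith
  constructor
  · have : (4.398 : ℝ) ≤ 2 * Real.exp 1 / (Real.sqrt 5 - 1) := by
      rw [le_div_iff₀ h5]
      linarith
    rw [gapConst]
    linarith
  · have : 2 * Real.exp 1 / (Real.sqrt 5 - 1) < 4.399 := by
      rw [div_lt_iff₀ h5]
      linarith
    rw [gapConst]
    linarith

/-- `w ≤ x exp (1 + x/w)` forces `w/x ≤ C₀ - 1`. If `w/x` were larger, then `t = x/w < 1/4`, and
`exp t ≤ 1/(1 - t)` bounds `w/x - 1` by `e`, although `e + 1 < 4.398 ≤ C₀ - 1`. -/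
theorem le_gapConst_sub_one_mul {w x : ℝ} (hw : 0 < w) (hx : 0 < x)
    (h : w ≤ x * Real.exp ((w + x) / w)) : w ≤ (gapConst - 1) * x := by
  obtain ⟨h1, -⟩ := gapConst_bounds
  have h3 := Real.exp_one_lt_d9
  by_contra! hlt
  set t := x / w with ht
  have ht0 : 0 < t := div_pos hx hw
  have hxt : x = t * w := by rw [ht, div_mul_cancel₀ _ hw.ne']
  have ht1 : t < 1 / 4 := by
    rw [ht, div_lt_iff₀ hw]
    nlinarith
  have h4 : Real.exp ((w + x) / w) = Real.exp 1 * Real.exp t := by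
    rw [← Real.exp_add, add_div, div_self hw.ne']
  have h5 : Real.exp t * (1 - t) ≤ 1 := by
    calc Real.exp t * (1 - t) ≤ Real.exp t * Real.exp (-t) := by
          refine mul_le_mul_of_nonneg_left ?_ (Real.exp_pos t).le
          linarith [Real.add_one_le_exp (-t)]
      _ = 1 := by rw [← Real.exp_add, add_neg_cancel, Real.exp_zero]
  rw [h4] at h
  have h6 : w * (1 - t) ≤ x * Real.exp 1 := by
    calc w * (1 - t) ≤ x * (Real.exp 1 * Real.exp t) * (1 - t) :=
          mul_le_mul_of_nonneg_right h (by linarith)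
      _ = x * Real.exp 1 * (Real.exp t * (1 - t)) := by ring
      _ ≤ x * Real.exp 1 * 1 := mul_le_mul_of_nonneg_left h5 (by positivity)
      _ = x * Real.exp 1 := mul_one _
  nlinarith

section Bands

variable {p q m : ℕ}

theorem bandCenter_eq (hm : q = 2 * m + 1) (j : ℤ) :
    bandCenter p q j = levelRoot (-discriminant p q) m 0 j := by
  rw [bandCenter, levelRoot, C_0, sub_zero, roots_neg, show (q - 1) / 2 = m by omega]

theorem band_eq (hm : q = 2 * m + 1) (hm1 : 1 ≤ m) (hpq : Nat.Coprime p q) {j : ℤ}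
    (hj : j ∈ Set.Icc (-(m : ℤ)) m) : band p q j =
      Set.Icc (lowerEdge (-discriminant p q) m j) (upperEdge (-discriminant p q) m j) := by
  rw [band, specUnion_eq (by omega) ⟨m, hm⟩ hpq, bandCenter_eq hm]
  exact (isBandPolynomial_neg_discriminant hm hpq).connectedComponentIn_center hj

theorem leftEdge_eq (hm : q = 2 * m + 1) (hm1 : 1 ≤ m) (hpq : Nat.Coprime p q) {j : ℤ}
    (hj : j ∈ Set.Icc (-(m : ℤ)) m) : leftEdge p q j = lowerEdge (-discriminant p q) m j := by
  rw [leftEdge, band_eq hm hm1 hpq hj,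
    csInf_Icc ((isBandPolynomial_neg_discriminant hm hpq).lowerEdge_lt_upperEdge hj).le]

theorem rightEdge_eq (hm : q = 2 * m + 1) (hm1 : 1 ≤ m) (hpq : Nat.Coprime p q) {j : ℤ}
    (hj : j ∈ Set.Icc (-(m : ℤ)) m) : rightEdge p q j = upperEdge (-discriminant p q) m j := by
  rw [rightEdge, band_eq hm hm1 hpq hj,
    csSup_Icc ((isBandPolynomial_neg_discriminant hm hpq).lowerEdge_lt_upperEdge hj).le]

end Bands

theorem lemma1 (p q : ℕ) (hq : 3 ≤ q) (hodd : Odd q) (hpq : Nat.Coprime p q) :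
    (rightWidth p q 0 / 4) ^ 2 < gapLength p q 0 ∧
    (∀ j : ℕ, 1 ≤ j → j < (q - 1) / 2 →
      rightWidth p q j ^ 2 / (4 * gapConst ^ (2 * (j + 1))) < gapLength p q j) ∧
    (∀ j : ℕ, 1 ≤ j → j < (q - 1) / 2 →
      (rightWidth p q 0 / 8) ^ (2 * j) < gapLength p q j) ∧
    5.398 ≤ gapConst ∧ gapConst < 5.399 := by
  obtain ⟨m, hm⟩ := id hodd
  have hm1 : 1 ≤ m := by omega
  have hqm : (q - 1) / 2 = m := by omega
  have h := isBandPolynomial_neg_discriminant hm hpq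
  set P := -discriminant p q with hP
  have hgap : ∀ j : ℤ, 0 ≤ j → j < m →
      gapLength p q j = lowerEdge P m (j + 1) - upperEdge P m j := by
    intro j hj0 hjm
    rw [gapLength, leftEdge_eq hm hm1 hpq ⟨by omega, by omega⟩,
      rightEdge_eq hm hm1 hpq ⟨by omega, by omega⟩]
  have hwidth : ∀ j : ℤ, 0 ≤ j → j < m →
      rightWidth p q j = upperEdge P m j - levelRoot P m 0 j := by
    intro j hj0 hjm
    rw [rightWidth, rightEdge_eq hm hm1 hpq ⟨by omega, by omega⟩, bandCenter_eq hm]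
  have hw0 : rightWidth p q 0 = upperEdge P m 0 := by
    rw [hwidth 0 le_rfl (by omega), h.center_zero, sub_zero]
  have hC := gapConst_bounds
  have hC0 : 0 < gapConst := by linarith [hC.1]
  refine ⟨?_, fun j hj hjq => ?_, fun j hj hjq => ?_, hC⟩
  · have key := h.sq_upperEdge_zero_lt (by omega)
    rw [hw0, hgap 0 le_rfl (by omega), zero_add]
    linarith
  · have hjm : j < m := by omega
    have hjI : (j : ℤ) ∈ Set.Icc (-(m : ℤ)) m := ⟨by omega, by omega⟩
    rw [hwidth j (by omega) (by omega), hgap j (by omega) (by omega), div_lt_iff₀ (by positivity),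
      mul_comm (lowerEdge P m (j + 1) - upperEdge P m j)]
    refine h.sq_width_lt hjm (by linarith [hC.1]) (le_gapConst_sub_one_mul
      (sub_pos.2 (h.center_lt_upperEdge hjI)) (sub_pos.2 (h.lowerEdge_lt_center hjI)) ?_)
    rw [sub_add_sub_cancel]
    exact h.width_le_mul_exp hjI
  · have hjm : j < m := by omega
    have hjI : (j : ℤ) ∈ Set.Icc (-(m : ℤ)) m := ⟨by omega, by omega⟩
    rw [hw0, hgap j (by omega) (by omega)]
    refine h.pow_upperEdge_zero_lt hj hjm ?_
    have hmem : upperEdge P m j ∈ specUnion ((p : ℝ) / q) := by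
      rw [specUnion_eq hq hodd hpq]
      exact (h.abs_eval_le_iff _).2 ⟨j, hjI, (h.lowerEdge_lt_upperEdge hjI).le, le_rfl⟩
    exact (le_abs_self _).trans (abs_le_four_of_mem_specUnion hmem)
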